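/- **Conventions.** Let $\mathcal C$ be an exact category in the sense of Quillen: an additive category with a class of kernel–cokernel pairs $0\to A\xrightarrow{i} B\xrightarrow{p} Z\to 0$ called conflations, satisfying the usual axioms; $i$ is then called an inflation and $p$ a deflation. A $\lambda$-sequence, for an ordinal $\lambda$, is a direct system $(X_\alpha)_{\alpha<\lambda}$ such that $X_\gamma=\operatorname{colim}_{\alpha<\gamma}X_\alpha$ for every limit ordinal $\gamma<\lambda$; if its colimit exists, the map $X_0\to\operatorname{colim}_{\alpha<\lambda}X_\alpha$ is its composition, and it is called a transfinite composition of morphisms of $\mathcal M$ if $X_\alpha\to X_{\alpha+1}$ lies in $\mathcal M$ whenever $\alpha+1<\lambda$. An object $X$ is small relative to a class $\mathcal M$ of morphisms if there is an infinite regular cardinal $\kappa$ such that for every ordinal $\lambda$ of cofinality at least $\kappa$ and every $\lambda$-sequence $(Y_\alpha)$ with a colimit and with all $Y_\alpha\to Y_{\alpha+1}$ in $\mathcal M$, the map $\operatorname{colim}_{\alpha}\operatorname{Hom}(X,Y_\alpha)\to\operatorname{Hom}(X,\operatorname{colim}_{\alpha} Y_\alpha)$ is an isomorphism. $\operatorname{Ext}^1(X,Y)$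 is the Yoneda Ext, the equivalence classes of conflations $0\to Y\to Z\to X\to 0$. For a class $\mathcal S$ of objects, $\mathcal S^{\perp_1}=\{Y : \operatorname{Ext}^1(S,Y)=0\ \forall S\in\mathcal S\}$ and ${}^{\perp_1}\mathcal S=\{X : \operatorname{Ext}^1(X,S)=0\ \forall S\in\mathcal S\}$. For a set $\mathcal I$ of inflations, let $\operatorname{Coker}(\mathcal I)$ be the class of objects isomorphic to the cokernel of some $i\in\mathcal I$. Let $\mathcal I\text{-Cells}$ be the class of objects $X$ such that $0\to X$ is a transfinite composition of pushouts of maps in $\mathcal I$. For a class $\mathcal S$ of objects, let $\operatorname{Filt}\mathcal S$ (the $\mathcal S$-filtered objects) be the class of objects $X$ such that $0\to X$ is a transfinite composition of inflations with cokernel in $\mathcal S$. The set $\mathcal I$ is homological if for every object $T$ one has $\operatorname{Ext}^1(S,T)=0$ for all $S\in\operatorname{Coker}(\mathcal I)$ if and only if $T\to 0$ has the right lifting property with respect to all maps in $\mathcal I$. It is strongly homological if for every conflation $0\to A\xrightarrow{j}B\to S\to 0$ with $S\in\operatorname{Coker}(\mathcal I)$ there are $i:A'\to B'$ in $\mathcal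 I$, a conflation $0\to A'\xrightarrow{i}B'\to S\to 0$, and a morphism from this conflation to the given one that is the identity on $S$. A class $\mathcal G$ of objects is generating if every object $M$ admits a deflation $G\to M$ with $G$ a set-indexed coproduct of objects of $\mathcal G$. A class $\mathcal F$ is precovering if every object $X$ admits a morphism $F\to X$ with $F\in\mathcal F$ through which every morphism from an object of $\mathcal F$ to $X$ factors; preenveloping is the dual notion. A pair $(\mathcal X,\mathcal Y)$ of classes of objects is a complete cotorsion pair if $\mathcal X^{\perp_1}=\mathcal Y$, $\mathcal X={}^{\perp_1}\mathcal Y$, and every object $M$ admits conflations $0\to Y\to X\to M\to0$ and $0\to M\to Y'\to X'\to 0$ with $X,X'\in\mathcal X$ and $Y,Y'\in\mathcal Y$. **Theorem.** Let $\mathcal C$ be an exact category in which arbitrary transfinite compositions of inflations exist and are inflations, and in which every object is small relative to the class of all inflations. Let $\mathcal I$ be a homological set of inflations, and put $\mathcal S=\operatorname{Coker}(\mathcal I)$ and $\mathcal T=\mathcal S^{\perp_1}$. Then: 1. $\mathcal I\text{-Cells}$ is precovering in $\mathcal C$. 2. $\mathcal I\text{-Cells}\subseteq\operatorname{Filt}\mathcal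 S$, and if $\mathcal I$ is strongly homological, then $\mathcal I\text{-Cells}=\operatorname{Filt}\mathcal S$. 3. $\mathcal T=(\mathcal I\text{-Cells})^{\perp_1}=(\operatorname{Filt}\mathcal S)^{\perp_1}$. 4. $\mathcal T$ is preenveloping in $\mathcal C$, and for each object $M$ there is a conflation $0\to M\to T\to X\to 0$ with $T\in\mathcal T$ and $X\in\mathcal I\text{-Cells}$. 5. If ${}^{\perp_1}\mathcal T$ is generating, then for each object $M$ there is a conflation $0\to T'\to X'\to M\to 0$ with $T'\in\mathcal T$ and $X'\in{}^{\perp_1}\mathcal T$; in particular, $({}^{\perp_1}\mathcal T,\mathcal T)$ is a complete cotorsion pair in $\mathcal C$. 6. If $\operatorname{Filt}\mathcal S$ is generating, then ${}^{\perp_1}\mathcal T$ consists precisely of the direct summands of $\mathcal S$-filtered objects. -/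

import Mathlib

open CategoryTheory CategoryTheory.Limits

universe v u

/-- The morphisms occurring as the first map of a sequence `0 ⟶ A ⟶ B ⟶ Z ⟶ 0` in `P`. -/
def firstMaps {C : Type u} [Category.{v} C] [HasZeroMorphisms C]
    (P : ObjectProperty (ShortComplex C)) : MorphismProperty C :=
  fun _ B f => ∃ (Z : C) (g : B ⟶ Z) (w : f ≫ g = 0), P (ShortComplex.mk f g w)

/-- The morphisms occurring as the second map of a sequence `0 ⟶ A ⟶ B ⟶ Z ⟶ 0` in `P`. -/
def secondMaps {C : Type u} [Category.{v} C] [HasZeroMorphisms C]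
    (P : ObjectProperty (ShortComplex C)) : MorphismProperty C :=
  fun B _ g => ∃ (A : C) (f : A ⟶ B) (w : f ≫ g = 0), P (ShortComplex.mk f g w)

/-- A (Quillen) exact structure on an additive category: a class of kernel-cokernel pairs
(the conflations), closed under isomorphisms, subject to the usual self-dual list of axioms. -/
structure ExactStructure (C : Type u) [Category.{v} C] [Preadditive C] where
  /-- the class of conflations -/
  conflation : ObjectProperty (ShortComplex C)
  of_iso : ∀ {S S' : ShortComplex C}, (S ≅ S') → conflation S → conflation S'
  isKernel : ∀ S : ShortComplex C, conflation S →
    Nonempty (IsLimit (KernelFork.ofι S.f S.zero))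
  isCokernel : ∀ S : ShortComplex C, conflation S →
    Nonempty (IsColimit (CokernelCofork.ofπ S.g S.zero))
  id_inflation : ∀ X : C, firstMaps conflation (𝟙 X)
  id_deflation : ∀ X : C, secondMaps conflation (𝟙 X)
  comp_inflation : ∀ {X Y Z : C} (f : X ⟶ Y) (g : Y ⟶ Z),
    firstMaps conflation f → firstMaps conflation g → firstMaps conflation (f ≫ g)
  comp_deflation : ∀ {X Y Z : C} (f : X ⟶ Y) (g : Y ⟶ Z),
    secondMaps conflation f → secondMaps conflation g → secondMaps conflation (f ≫ g)
  pushout_inflation : ∀ {A B A' : C} (i : A ⟶ B) (f : A ⟶ A'), firstMaps conflation i →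
    ∃ (B' : C) (f' : B ⟶ B') (i' : A' ⟶ B'), IsPushout i f f' i' ∧ firstMaps conflation i'
  pullback_deflation : ∀ {B Z Z' : C} (p : B ⟶ Z) (f : Z' ⟶ Z), secondMaps conflation p →
    ∃ (B' : C) (f' : B' ⟶ B) (p' : B' ⟶ Z'), IsPullback f' p' p f ∧ secondMaps conflation p'

namespace ExactStructure

variable {C : Type u} [Category.{v} C] [Preadditive C] (E : ExactStructure C)

/-- `0 ⟶ A ⟶ B ⟶ Z ⟶ 0` (with maps `f` and `g`) is a conflation. -/
def IsConflation {A B Z : C} (f : A ⟶ B) (g : B ⟶ Z) : Prop :=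
  ∃ w : f ≫ g = 0, E.conflation (ShortComplex.mk f g w)

/-- The class of all inflations. -/
def inflations : MorphismProperty C := firstMaps E.conflation

/-- The class of all deflations. -/
def deflations : MorphismProperty C := secondMaps E.conflation

/-! ### Axioms on transfinite compositions and smallness

`λ`-sequences are well-order-continuous functors on nonempty well-ordered types `J`; sets are
the `v`-small types, where `v` is the universe of the Hom-sets. -/

/-- Arbitrary transfinite compositions of inflations exist and are again inflations. -/
def HasTransfiniteCompositions : Prop :=
  ∀ (J : Type v) [LinearOrder J] [SuccOrder J] [OrderBot J] [WellFoundedLT J]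
    (F : J ⥤ C) [F.IsWellOrderContinuous],
    (∀ j : J, ¬ IsMax j → E.inflations (F.map (homOfLE (Order.le_succ j)))) →
      ∃ c : Cocone F, Nonempty (IsColimit c) ∧ E.inflations (c.ι.app ⊥)

end ExactStructure

/-- `X` is `κ`-small relative to `W`: for every `λ`-sequence `F` of morphisms of `W` with `λ` of
cofinality at least `κ`, the functor `Hom(X, -)` preserves the colimit of `F` if it exists. -/
def IsCardinalSmallRelativeTo {C : Type u} [Category.{v} C] (X : C) (W : MorphismProperty C)
    (κ : Cardinal.{v}) : Prop :=
  ∀ (J : Type v) [LinearOrder J] [SuccOrder J] [OrderBot J] [WellFoundedLT J],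
    κ ≤ Order.cof J → ∀ (F : J ⥤ C) [F.IsWellOrderContinuous],
      (∀ j : J, ¬ IsMax j → W (F.map (homOfLE (Order.le_succ j)))) →
        PreservesColimit F (coyoneda.obj (Opposite.op X))

/-- `X` is small relative to `W`. -/
def IsSmallRelativeTo {C : Type u} [Category.{v} C] (X : C) (W : MorphismProperty C) : Prop :=
  ∃ κ : Cardinal.{v}, κ.IsRegular ∧ IsCardinalSmallRelativeTo X W κ

/-- `F` is precovering: every object `X` has an `F`-precover. -/
def IsPrecovering {C : Type u} [Category.{v} C] (F : ObjectProperty C) : Prop :=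
  ∀ X : C, ∃ (A : C) (f : A ⟶ X), F A ∧
    ∀ (A' : C) (f' : A' ⟶ X), F A' → ∃ h : A' ⟶ A, h ≫ f = f'

/-- `F` is preenveloping: every object `X` has an `F`-preenvelope. -/
def IsPreenveloping {C : Type u} [Category.{v} C] (F : ObjectProperty C) : Prop :=
  ∀ X : C, ∃ (A : C) (f : X ⟶ A), F A ∧
    ∀ (A' : C) (f' : X ⟶ A'), F A' → ∃ h : A ⟶ A', f ≫ h = f'

/-- `I`-cell complexes: objects `X` such that `0 ⟶ X` is a transfinite composition of pushouts
of maps in `I`. -/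
def cellObjects {C : Type u} [Category.{v} C] [HasZeroMorphisms C] [HasZeroObject C]
    (I : MorphismProperty C) : ObjectProperty C :=
  open ZeroObject in
  fun X => MorphismProperty.transfiniteCompositions.{v} I.pushouts (0 : (0 : C) ⟶ X)

/-- Direct summands of objects of `P`. -/
def directSummands {C : Type u} [Category.{v} C] [Preadditive C] [HasBinaryBiproducts C]
    (P : ObjectProperty C) : ObjectProperty C :=
  fun M => ∃ N X : C, P X ∧ Nonempty (X ≅ M ⊞ N)

namespace ExactStructure

/-! ### The Yoneda `Ext¹` -/

section Ext

variable {C : Type u} [Category.{v} C] [Preadditive C] (E : ExactStructure C)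

/-- An extension `0 ⟶ Y ⟶ Z ⟶ X ⟶ 0` of `X` by `Y`. -/
structure Extension (X Y : C) where
  /-- the middle term -/
  mid : C
  /-- the inflation -/
  ι : Y ⟶ mid
  /-- the deflation -/
  π : mid ⟶ X
  isConflation : E.IsConflation ι π

/-- Two extensions are equivalent if there is an isomorphism between them which is the identity
on both ends. -/
def Extension.setoid (X Y : C) : Setoid (E.Extension X Y) where
  r a b := ∃ e : a.mid ≅ b.mid, a.ι ≫ e.hom = b.ι ∧ e.hom ≫ b.π = a.π
  iseqv :=
    { refl := fun a => ⟨Iso.refl _, by simp, by simp⟩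
      symm := by
        rintro a b ⟨e, h₁, h₂⟩
        exact ⟨e.symm, by simp [← h₁], by simp [← h₂]⟩
      trans := by
        rintro a b c ⟨e, h₁, h₂⟩ ⟨e', h₁', h₂'⟩
        exact ⟨e ≪≫ e', by simp [← h₁', ← h₁], by simp [← h₂, ← h₂']⟩ }

/-- The underlying class of the Yoneda `Ext¹(X, Y)`: equivalence classes of conflations
`0 ⟶ Y ⟶ Z ⟶ X ⟶ 0`. -/
def Ext1 (X Y : C) : Type (max u v) := Quotient (Extension.setoid E X Y)

variable [HasBinaryBiproducts C]

theorem isConflation_split (X Y : C) :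
    E.IsConflation (biprod.inl : Y ⟶ Y ⊞ X) (biprod.snd : Y ⊞ X ⟶ X) := by
  obtain ⟨K, k, wk, hk⟩ := E.id_deflation X
  have hk0 : k = 0 := by simpa using wk
  obtain ⟨hlim⟩ := E.isKernel _ hk
  have hKid : 𝟙 K = 0 := by
    apply Fork.IsLimit.hom_ext hlim
    simp [hk0]
  obtain ⟨P, a, b, hP, Q, q, wq, hq⟩ := E.pushout_inflation k (0 : K ⟶ Y) ⟨X, 𝟙 X, wk, hk⟩
  -- the pushout over the zero object `K` is the biproduct
  let p₁ : P ⟶ Y := hP.desc (0 : X ⟶ Y) (𝟙 Y) (by simp)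
  let p₂ : P ⟶ X := hP.desc (𝟙 X) (0 : Y ⟶ X) (by simp [hk0])
  have ha1 : a ≫ p₁ = 0 := hP.inl_desc _ _ _
  have hb1 : b ≫ p₁ = 𝟙 Y := hP.inr_desc _ _ _
  have ha2 : a ≫ p₂ = 𝟙 X := hP.inl_desc _ _ _
  have hb2 : b ≫ p₂ = 0 := hP.inr_desc _ _ _
  let e : P ≅ Y ⊞ X :=
    { hom := biprod.lift p₁ p₂
      inv := biprod.desc b a
      hom_inv_id := by
        apply hP.hom_ext
        · simp [biprod.lift_desc, reassoc_of% ha1, reassoc_of% ha2]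
        · simp [biprod.lift_desc, reassoc_of% hb1, reassoc_of% hb2]
      inv_hom_id := by
        ext <;> simp [ha1, hb1, ha2, hb2] }
  obtain ⟨hcol⟩ := E.isCokernel _ hq
  have haq : p₂ ≫ a ≫ q = q := by
    apply hP.hom_ext
    · simp [reassoc_of% ha2]
    · simp [reassoc_of% hb2, wq]
  let t : Q ⟶ X := hcol.desc (CokernelCofork.ofπ p₂ hb2)
  have ht : q ≫ t = p₂ := hcol.fac (CokernelCofork.ofπ p₂ hb2) WalkingParallelPair.one
  let e' : Q ≅ X :=
    { hom := t
      inv := a ≫ q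
      hom_inv_id := by
        apply Cofork.IsColimit.hom_ext hcol
        change q ≫ t ≫ a ≫ q = q ≫ 𝟙 Q
        rw [reassoc_of% ht, haq, Category.comp_id]
      inv_hom_id := by rw [Category.assoc, ht, ha2] }
  refine ⟨by simp, E.of_iso ?_ hq⟩
  refine ShortComplex.isoMk (Iso.refl _) e e' ?_ ?_
  · ext <;> simp [e, hb1, hb2]
  · simp [e, e', ht]

/-- The class of the split extension, which is the zero element of `Ext¹(X, Y)`. -/
noncomputable instance instZeroExt1 (X Y : C) : Zero (E.Ext1 X Y) :=
  ⟨Quotient.mk (Extension.setoid E X Y) ⟨Y ⊞ X, biprod.inl, biprod.snd, E.isConflation_split X Y⟩⟩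

/-- `Ext¹(X, Y) = 0`. -/
def Ext1IsZero (X Y : C) : Prop := ∀ e : E.Ext1 X Y, e = 0

/-- `S^{⊥₁}`, the objects `Y` with `Ext¹(X, Y) = 0` for all `X` in `S`. -/
def rightPerp (S : ObjectProperty C) : ObjectProperty C :=
  fun Y => ∀ X : C, S X → E.Ext1IsZero X Y

/-- `^{⊥₁}S`, the objects `X` with `Ext¹(X, Y) = 0` for all `Y` in `S`. -/
def leftPerp (S : ObjectProperty C) : ObjectProperty C :=
  fun X => ∀ Y : C, S Y → E.Ext1IsZero X Y

/-- `(A, B)` is a complete cotorsion pair. -/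
structure IsCompleteCotorsionPair (A B : ObjectProperty C) : Prop where
  rightPerp_eq : E.rightPerp A = B
  leftPerp_eq : A = E.leftPerp B
  left_approx : ∀ M : C, ∃ (Y X : C) (f : Y ⟶ X) (g : X ⟶ M), A X ∧ B Y ∧ E.IsConflation f g
  right_approx : ∀ M : C, ∃ (Y X : C) (f : M ⟶ Y) (g : Y ⟶ X), A X ∧ B Y ∧ E.IsConflation f g

end Ext

/-! ### Sets of inflations, filtrations, generators -/

section Classes

variable {C : Type u} [Category.{v} C] [Preadditive C] (E : ExactStructure C)

/-- `Coker(I)`, the objects which are a cokernel of some morphism in `I`. (For an inflation `i`,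
these are the third terms of the conflations starting with `i`.) -/
def cokers (I : MorphismProperty C) : ObjectProperty C :=
  fun S => ∃ (A B : C) (i : A ⟶ B) (p : B ⟶ S), I i ∧ E.IsConflation i p

/-- The inflations with a cokernel in `S`. -/
def inflationsWithCokerIn (S : ObjectProperty C) : MorphismProperty C :=
  fun _ B f => ∃ (Z : C) (g : B ⟶ Z), S Z ∧ E.IsConflation f g

/-- `I` is a set of inflations. -/
def IsSetOfInflations (I : MorphismProperty C) : Prop :=
  MorphismProperty.IsSmall.{v} I ∧ I ≤ E.inflations

/-- The set `I` of inflations is strongly homological. -/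
def IsStronglyHomological (I : MorphismProperty C) : Prop :=
  ∀ (A B S : C) (j : A ⟶ B) (q : B ⟶ S), E.IsConflation j q → E.cokers I S →
    ∃ (A' B' : C) (i : A' ⟶ B') (p : B' ⟶ S) (a : A' ⟶ A) (b : B' ⟶ B),
      I i ∧ E.IsConflation i p ∧ i ≫ b = a ≫ j ∧ b ≫ q = p

/-- `G` is generating: every object is the target of a deflation from a set-indexed coproduct
of objects in `G`. -/
def IsGenerating (G : ObjectProperty C) : Prop :=
  ∀ M : C, ∃ (K : Type v) (A : K → C) (c : Cofan A) (π : c.pt ⟶ M),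
    (∀ k, G (A k)) ∧ Nonempty (IsColimit c) ∧ E.deflations π

variable [HasZeroObject C]

/-- `Filt S`, the class of `S`-filtered objects. -/
def filt (S : ObjectProperty C) : ObjectProperty C :=
  open ZeroObject in
  fun X => MorphismProperty.transfiniteCompositions.{v} (E.inflationsWithCokerIn S)
    (0 : (0 : C) ⟶ X)

/-- The set `I` of inflations is homological: for every `T`, one has `Ext¹(S, T) = 0` for all
`S ∈ Coker(I)` if and only if `T ⟶ 0` has the right lifting property with respect to `I`. -/
def IsHomological [HasBinaryBiproducts C] (I : MorphismProperty C) : Prop :=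
  open ZeroObject in
  ∀ T : C, (∀ S : C, E.cokers I S → E.Ext1IsZero S T) ↔ I.rlp (0 : T ⟶ (0 : C))

end Classes

end ExactStructure

/-! The proof turns `Ext¹` into lifting. `Ext¹(X, T) = 0` exactly when `0 ⟶ X` lifts against all
deflations with kernel `T` (`ext1IsZero_iff_llp`), and for `T` in `S^{⊥₁}` all inflations with
cokernel in `S` lift against them (`IsConflation.hasLiftingProperty`). Lifting classes are closed
under transfinite composition; this is Eklof's lemma, and it shows that `S`, the cell objects and
the filtered objects have the same right orthogonal.

The small object argument (`HasTransfiniteCompositions.exists_factorization`) factors every map into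
a transfinite composition of pushouts of maps in `I`, followed by a map in `I.rlp`. For `0 ⟶ X` this
yields the precover. For `M ⟶ 0`, homologicality puts the middle object `T` in `S^{⊥₁}`, and the
cokernel of `M ⟶ T` is a cell object because transfinite compositions of this kind are stable under
cobase change. Salce's trick embeds the kernel of a deflation `G ⟶ M` into such a `T` and pushes
out: the new object `P` is an extension of `M` by `T` and also of a cell object by `G`. If `G` is
filtered, so is `P`; if moreover `Ext¹(M, T) = 0`, then `M` is a summand of `P`.

The labour comes from the scarcity of colimits, since only transfinite compositions of inflations
are available. A set of cells is attached one cell at a time along a well-order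
(`HasTransfiniteCompositions.exists_cellAttachment`). Iterated transfinite compositions are
flattened by viewing them as well-ordered sets of subobjects, which can be refined
(`IsTower.refine`). The transfinite iteration is carried out in a cocomplete category containing the
given one and is then seen not to leave it (`exists_iteration`). -/

namespace ExactStructure

/-! ### Basic properties of conflations -/

section Basic

variable {C : Type u} [Category.{v} C] [Preadditive C] {E : ExactStructure C}

namespace IsConflation

variable {A B Z : C} {f : A ⟶ B} {g : B ⟶ Z}

lemma zero (h : E.IsConflation f g) : f ≫ g = 0 := h.1

lemma inflation (h : E.IsConflation f g) : E.inflations f := ⟨Z, g, h⟩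

lemma deflation (h : E.IsConflation f g) : E.deflations g := ⟨A, f, h⟩

lemma mono (h : E.IsConflation f g) : Mono f := by
  obtain ⟨w, h⟩ := h
  obtain ⟨hl⟩ := E.isKernel _ h
  exact ⟨fun _ _ e => Fork.IsLimit.hom_ext hl e⟩

lemma epi (h : E.IsConflation f g) : Epi g := by
  obtain ⟨w, h⟩ := h
  obtain ⟨hl⟩ := E.isCokernel _ h
  exact ⟨fun _ _ e => Cofork.IsColimit.hom_ext hl e⟩

lemma exists_lift (h : E.IsConflation f g) {W : C} (t : W ⟶ B) (ht : t ≫ g = 0) :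
    ∃ l : W ⟶ A, l ≫ f = t := by
  obtain ⟨w, h⟩ := h
  obtain ⟨hl⟩ := E.isKernel _ h
  exact ⟨hl.lift (KernelFork.ofι t ht), hl.fac _ WalkingParallelPair.zero⟩

lemma exists_desc (h : E.IsConflation f g) {W : C} (t : B ⟶ W) (ht : f ≫ t = 0) :
    ∃ l : Z ⟶ W, g ≫ l = t := by
  obtain ⟨w, h⟩ := h
  obtain ⟨hl⟩ := E.isCokernel _ h
  exact ⟨hl.desc (CokernelCofork.ofπ t ht), hl.fac _ WalkingParallelPair.one⟩

lemma of_iso {A' B' Z' : C} {f' : A' ⟶ B'} {g' : B' ⟶ Z'} (h : E.IsConflation f g)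
    (a : A ≅ A') (b : B ≅ B') (z : Z ≅ Z') (h₁ : f ≫ b.hom = a.hom ≫ f')
    (h₂ : g ≫ z.hom = b.hom ≫ g') : E.IsConflation f' g' := by
  obtain ⟨w, h⟩ := h
  have w' : f' ≫ g' = 0 := by
    rw [← cancel_epi a.hom, ← Category.assoc, ← h₁, Category.assoc, ← h₂, ← Category.assoc, w]
    simp
  exact ⟨w', E.of_iso (ShortComplex.isoMk a b z h₁.symm h₂.symm) h⟩

lemma of_isCokernel {Z' : C} {g' : B ⟶ Z'} (h : E.IsConflation f g) (w : f ≫ g' = 0)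
    (hd : ∀ {W : C} (t : B ⟶ W), f ≫ t = 0 → ∃ l : Z' ⟶ W, g' ≫ l = t) (he : Epi g') :
    E.IsConflation f g' := by
  obtain ⟨a, ha⟩ := h.exists_desc g' w
  obtain ⟨b, hb⟩ := hd g h.zero
  have := h.epi
  refine h.of_iso (Iso.refl _) (Iso.refl _) ⟨a, b, ?_, ?_⟩ (by simp) (by simp [ha])
  · rw [← cancel_epi g, reassoc_of% ha, hb, Category.comp_id]
  · rw [← cancel_epi g', reassoc_of% hb, ha, Category.comp_id]

lemma of_isKernel {A' : C} {f' : A' ⟶ B} (h : E.IsConflation f g) (w : f' ≫ g = 0)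
    (hd : ∀ {W : C} (t : W ⟶ B), t ≫ g = 0 → ∃ l : W ⟶ A', l ≫ f' = t) (he : Mono f') :
    E.IsConflation f' g := by
  obtain ⟨a, ha⟩ := h.exists_lift f' w
  obtain ⟨b, hb⟩ := hd f h.zero
  have := h.mono
  refine h.of_iso ⟨b, a, ?_, ?_⟩ (Iso.refl _) (Iso.refl _) (by simp [hb]) (by simp)
  · rw [← cancel_mono f, Category.assoc, ha, hb, Category.id_comp]
  · rw [← cancel_mono f', Category.assoc, hb, ha, Category.id_comp]

end IsConflation

instance : E.inflations.RespectsIso :=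
  MorphismProperty.RespectsIso.of_respects_arrow_iso _ (by
    rintro f f' e ⟨Z, g, h⟩
    exact (IsConflation.of_iso (E := E) (f' := f'.hom) (g' := e.inv.right ≫ g) h
      (Arrow.leftFunc.mapIso e) (Arrow.rightFunc.mapIso e) (Iso.refl Z) (Arrow.w e.hom).symm
      (by
        have : e.hom.right ≫ e.inv.right = 𝟙 _ := by rw [← Arrow.comp_right, e.hom_inv_id]; rfl
        change g ≫ 𝟙 Z = e.hom.right ≫ e.inv.right ≫ g
        rw [reassoc_of% this, Category.comp_id])).inflation)

lemma inflations_mono {A B : C} {f : A ⟶ B} (h : E.inflations f) : Mono f := by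
  obtain ⟨Z, g, h⟩ := h
  exact IsConflation.mono (E := E) h

lemma inflations_of_isPushout {A B A' B' : C} {i : A ⟶ B} {f : A ⟶ A'} {f' : B ⟶ B'}
    {i' : A' ⟶ B'} (hP : IsPushout i f f' i') (hi : E.inflations i) : E.inflations i' := by
  obtain ⟨B'', f'', i'', hQ, h⟩ := E.pushout_inflation i f hi
  have e : i'' ≫ (hQ.isoIsPushout _ _ hP).hom = i' := by simp
  rw [← e]
  exact (MorphismProperty.cancel_right_of_respectsIso E.inflations _ _).2 h

instance : E.inflations.IsStableUnderCobaseChange where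
  of_isPushout h hi := inflations_of_isPushout h.flip hi

/-- Every kernel of an identity is zero, and any zero object serves as well. This makes `0 ⟶ X` an
inflation with cokernel `X`, the link between `Ext¹` and lifting. -/
lemma isConflation_of_isZero {A X : C} (hA : IsZero A) (f : A ⟶ X) : E.IsConflation f (𝟙 X) := by
  obtain ⟨K, k, hk⟩ := E.id_deflation X
  replace hk : E.IsConflation k (𝟙 X) := hk
  refine hk.of_isKernel (by rw [hA.eq_of_src f 0, zero_comp]) ?_
    ⟨fun a b _ => hA.eq_of_tgt _ _⟩
  intro W t ht
  exact ⟨0, by simpa using ht.symm⟩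

/-- The pushout of an inflation has the same cokernel. -/
lemma IsConflation.of_isPushout {A B A' B' Z : C} {i : A ⟶ B} {f : A ⟶ A'} {f' : B ⟶ B'}
    {i' : A' ⟶ B'} {p : B ⟶ Z} (hP : IsPushout i f f' i') (h : E.IsConflation i p) :
    ∃ p' : B' ⟶ Z, E.IsConflation i' p' ∧ f' ≫ p' = p := by
  obtain ⟨Q, q, hq⟩ := inflations_of_isPushout hP h.inflation
  refine ⟨hP.desc p 0 (by simp [h.zero]), ?_, by simp⟩
  refine IsConflation.of_isCokernel (E := E) hq (by simp) ?_ ?_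
  · intro W t ht
    obtain ⟨l, hl⟩ := h.exists_desc (f' ≫ t) (by rw [reassoc_of% hP.w, ht, comp_zero])
    exact ⟨l, hP.hom_ext (by simp [hl]) (by simp [ht])⟩
  · have := h.epi
    refine ⟨fun a b hab => ?_⟩
    rw [← cancel_epi p]
    simpa using f' ≫= hab

/-- The pullback of a deflation has the same kernel. -/
lemma IsConflation.exists_pullback {K B Z Z' : C} {k : K ⟶ B} {p : B ⟶ Z}
    (h : E.IsConflation k p) (f : Z' ⟶ Z) :
    ∃ (B' : C) (f' : B' ⟶ B) (p' : B' ⟶ Z') (k' : K ⟶ B'), IsPullback f' p' p f ∧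
      E.IsConflation k' p' ∧ k' ≫ f' = k := by
  obtain ⟨B', f', p', hP, K', k', hk'⟩ := E.pullback_deflation p f h.deflation
  refine ⟨B', f', p', hP.lift k 0 (by simp [h.zero]), hP, ?_, by simp⟩
  refine IsConflation.of_isKernel (E := E) hk' (by simp) ?_ ?_
  · intro W t ht
    obtain ⟨l, hl⟩ := h.exists_lift (t ≫ f') (by rw [Category.assoc, hP.w, reassoc_of% ht, zero_comp])
    exact ⟨l, hP.hom_ext (by simp [hl]) (by simp [ht])⟩
  · have := h.mono
    refine ⟨fun a b hab => ?_⟩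
    rw [← cancel_mono k]
    simpa using hab =≫ f'

/-- A morphism of conflations which is the identity on both ends is an isomorphism. -/
lemma IsConflation.isIso_of_id {A B B' S : C} {j : A ⟶ B} {q : B ⟶ S} {j' : A ⟶ B'}
    {q' : B' ⟶ S} (h : E.IsConflation j q) (h' : E.IsConflation j' q') (φ : B ⟶ B')
    (h₁ : j ≫ φ = j') (h₂ : φ ≫ q' = q) : IsIso φ := by
  obtain ⟨R, fst, snd, hR, -⟩ := E.pullback_deflation q q' h.deflation
  obtain ⟨K, k, hk⟩ := show E.deflations snd by
    obtain ⟨R', fst', snd', k', hR', hc, -⟩ := h.exists_pullback q'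
    exact ⟨A, (k' ≫ (hR'.isoIsPullback _ _ hR).hom), IsConflation.of_iso (E := E) hc (Iso.refl _)
      (hR'.isoIsPullback _ _ hR) (Iso.refl _) (by simp) (by simp)⟩
  replace hk : E.IsConflation k snd := hk
  have := h'.mono
  have := h.mono
  have := hk.epi
  -- On elements: for `(b, b')` in `R` the difference `b' - φ b` lies in `A`, and the inverse `ψ`
  -- sends `b'` to `b + (b' - φ b)`, which does not depend on the choice of `b`.
  obtain ⟨r, hr⟩ := h'.exists_lift (snd - fst ≫ φ) (by simp [h₂, hR.w])
  have hψ : k ≫ (fst + r ≫ j) = 0 := by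
    obtain ⟨l, hl⟩ := h.exists_lift (k ≫ fst) (by rw [Category.assoc, hR.w, ← Category.assoc,
      hk.zero, zero_comp])
    have : k ≫ r = - l := by
      rw [← cancel_mono j', Category.assoc, hr, Preadditive.comp_sub, hk.zero, ← Category.assoc,
        ← hl, Category.assoc, h₁]
      simp
    rw [Preadditive.comp_add, reassoc_of% this, ← hl]
    simp
  obtain ⟨ψ, hψ⟩ := hk.exists_desc _ hψ
  refine ⟨ψ, ?_, ?_⟩
  · let s : B ⟶ R := hR.lift (𝟙 B) φ (by simp [h₂])
    have hs : s ≫ r = 0 := by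
      rw [← cancel_mono j', Category.assoc, hr]
      simp [s]
    have : s ≫ snd ≫ ψ = φ ≫ ψ := by simp [s]
    rw [← this, hψ, Preadditive.comp_add, reassoc_of% hs]
    simp [s]
  · rw [← cancel_epi snd, reassoc_of% hψ, Preadditive.add_comp, Category.assoc, h₁, hr]
    simp

/-- In a morphism of conflations which is the identity on the third term, the square on the left
is a pushout. -/
lemma IsConflation.isPushout {A' B' A B S : C} {i : A' ⟶ B'} {p : B' ⟶ S} {j : A ⟶ B}
    {q : B ⟶ S} {a : A' ⟶ A} {b : B' ⟶ B} (h' : E.IsConflation i p) (h : E.IsConflation j q)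
    (h₁ : i ≫ b = a ≫ j) (h₂ : b ≫ q = p) : IsPushout i a b j := by
  obtain ⟨P, b', j', hP, -⟩ := E.pushout_inflation i a h'.inflation
  obtain ⟨q', hq', e⟩ := h'.of_isPushout hP
  let φ := hP.desc b j h₁
  have : IsIso φ := hq'.isIso_of_id h φ (by simp [φ])
    (hP.hom_ext (by simp [φ, h₂, e]) (by simp [φ, h.zero, hq'.zero]))
  exact IsPushout.of_iso hP (Iso.refl _) (Iso.refl _) (Iso.refl _) (asIso φ) (by simp) (by simp)
    (by simp [φ]) (by simp [φ])

instance (S : ObjectProperty C) : (E.inflationsWithCokerIn S).IsStableUnderCobaseChange where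
  of_isPushout := by
    rintro A A' B B' f g f' g' h ⟨Z, p, hZ, hc⟩
    obtain ⟨p', hp', -⟩ := hc.of_isPushout h.flip
    exact ⟨Z, p', hZ, hp'⟩

lemma inflationsWithCokerIn_le (S : ObjectProperty C) :
    E.inflationsWithCokerIn S ≤ E.inflations := by
  rintro _ _ _ ⟨Z, p, -, h⟩
  exact h.inflation

lemma pushouts_le_inflationsWithCokerIn {I : MorphismProperty C} (hI : I ≤ E.inflations) :
    I.pushouts ≤ E.inflationsWithCokerIn (E.cokers I) := by
  rw [MorphismProperty.pushouts_le_iff]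
  intro A B f hf
  obtain ⟨Z, p, h⟩ := hI f hf
  exact ⟨Z, p, ⟨A, B, f, p, hf, h⟩, h⟩

/-- The morphism of conflations given by the hypothesis is the identity on the cokernels, so its
left square is a pushout. -/
lemma IsStronglyHomological.inflationsWithCokerIn_le {I : MorphismProperty C}
    (h : E.IsStronglyHomological I) :
    E.inflationsWithCokerIn (E.cokers I) ≤ I.pushouts := by
  rintro A B j ⟨S, q, hS, hc⟩
  obtain ⟨A', B', i, p, a, b, hi, hip, h₁, h₂⟩ := h A B S j q hc hS
  exact MorphismProperty.pushouts_mk _ (hip.isPushout hc h₁ h₂).flip hi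

end Basic

/-! ### Vanishing of `Ext¹` and lifting properties -/

section Ext

variable {C : Type u} [Category.{v} C] [Preadditive C] {E : ExactStructure C}

/-- A retraction of the inflation of a conflation yields a section of the deflation. -/
lemma IsConflation.exists_section {A B Z : C} {f : A ⟶ B} {g : B ⟶ Z} (h : E.IsConflation f g)
    (ρ : B ⟶ A) (hρ : f ≫ ρ = 𝟙 A) : ∃ t : Z ⟶ B, t ≫ g = 𝟙 Z ∧ g ≫ t = 𝟙 B - ρ ≫ f := by
  obtain ⟨t, ht⟩ := h.exists_desc (𝟙 B - ρ ≫ f) (by simp [reassoc_of% hρ])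
  have := h.epi
  exact ⟨t, by simp [← cancel_epi g, reassoc_of% ht, h.zero], ht⟩

lemma IsConflation.exists_retraction {A B Z : C} {f : A ⟶ B} {g : B ⟶ Z}
    (h : E.IsConflation f g) (t : Z ⟶ B) (ht : t ≫ g = 𝟙 Z) :
    ∃ ρ : B ⟶ A, f ≫ ρ = 𝟙 A ∧ ρ ≫ f = 𝟙 B - g ≫ t := by
  obtain ⟨ρ, hρ⟩ := h.exists_lift (𝟙 B - g ≫ t) (by simp [ht])
  have := h.mono
  exact ⟨ρ, by simp [← cancel_mono f, hρ, reassoc_of% h.zero], hρ⟩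

variable [HasBinaryBiproducts C]

/-- The middle term of a split conflation is a biproduct. -/
lemma IsConflation.exists_iso_biprod {A B Z : C} {f : A ⟶ B} {g : B ⟶ Z}
    (h : E.IsConflation f g) (t : Z ⟶ B) (ht : t ≫ g = 𝟙 Z) :
    ∃ e : B ≅ A ⊞ Z, f ≫ e.hom = biprod.inl ∧ e.hom ≫ biprod.snd = g := by
  obtain ⟨ρ, h₁, h₂⟩ := h.exists_retraction t ht
  have := h.mono
  have h₃ : t ≫ ρ = 0 := by simp [← cancel_mono f, h₂, reassoc_of% ht]
  refine ⟨⟨biprod.lift ρ g, biprod.desc f t, ?_, ?_⟩, ?_, ?_⟩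
  · simp [biprod.lift_desc, h₂]
  · ext <;> simp [h₁, h₃, h.zero, ht]
  · ext <;> simp [h₁, h.zero]
  · simp

/-- From here on `Ext¹` enters only through this splitting criterion and its lifting form; the
quotient by equivalence is no longer needed. -/
lemma ext1IsZero_iff {X Y : C} : E.Ext1IsZero X Y ↔
    ∀ {Z : C} (f : Y ⟶ Z) (g : Z ⟶ X), E.IsConflation f g → ∃ t : X ⟶ Z, t ≫ g = 𝟙 X := by
  constructor
  · intro h Z f g hc
    obtain ⟨e, h₁, h₂⟩ := Quotient.exact (h (Quotient.mk _ ⟨Z, f, g, hc⟩))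
    have h₃ : e.inv ≫ g = biprod.snd := (Iso.inv_comp_eq e).2 h₂.symm
    exact ⟨biprod.inr ≫ e.inv, by rw [Category.assoc, h₃]; exact biprod.inr_snd⟩
  · intro h e
    induction e using Quotient.inductionOn with
    | h e =>
      obtain ⟨Z, f, g, hc⟩ := e
      obtain ⟨t, ht⟩ := h f g hc
      exact Quotient.sound (hc.exists_iso_biprod t ht)

/-- If `Ext¹(S, T) = 0`, inflations with cokernel `S` have the left lifting property with respect
to deflations with kernel `T`. -/
lemma IsConflation.hasLiftingProperty {A B S T Z X : C} {i : A ⟶ B} {q : B ⟶ S} {k : T ⟶ Z}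
    {p : Z ⟶ X} (hi : E.IsConflation i q) (hp : E.IsConflation k p) (h : E.Ext1IsZero S T) :
    HasLiftingProperty i p where
  sq_hasLift {a b} sq := by
    -- A lift is the same as a section of the pulled back deflation `π` that restricts to `s` on
    -- `A`.
    obtain ⟨P, b', π, ι, hP, hπ, hι⟩ := hp.exists_pullback b
    let s : A ⟶ P := hP.lift a i sq.w
    -- `K` is the preimage of `A` in `P`. It is the sum of `T`, via `ι`, and `A`, via `s`; the map
    -- `r` below is the projection to `T` that kills `s`.
    obtain ⟨K, κ, hκ⟩ := E.comp_deflation π q hπ.deflation hi.deflation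
    replace hκ : E.IsConflation κ (π ≫ q) := hκ
    obtain ⟨κ', hκ'⟩ := hi.exists_lift (κ ≫ π) (by simpa using hκ.zero)
    obtain ⟨r, hr⟩ := hπ.exists_lift (κ - κ' ≫ s) (by simp [s, hκ'])
    have := hπ.mono
    have := hi.mono
    have := hκ.mono
    -- Pushing out along `r` gives an extension of `S` by `T`. It splits, so `r` extends from `K` to
    -- all of `P`.
    obtain ⟨P', r', ι', hP', -⟩ := E.pushout_inflation κ r hκ.inflation
    obtain ⟨q', hq', -⟩ := hκ.of_isPushout hP'
    obtain ⟨t', ht'⟩ := ext1IsZero_iff.1 h _ _ hq'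
    obtain ⟨ρ', hρ', -⟩ := hq'.exists_retraction t' ht'
    have hρ : κ ≫ r' ≫ ρ' = r := by rw [reassoc_of% hP'.w, hρ', Category.comp_id]
    have hιρ : ι ≫ r' ≫ ρ' = 𝟙 T := by
      obtain ⟨l, hl⟩ := hκ.exists_lift ι (by rw [← Category.assoc, hπ.zero, zero_comp])
      have hl' : l ≫ κ' = 0 := by
        rw [← cancel_mono i, Category.assoc, hκ', reassoc_of% hl, hπ.zero, zero_comp]
      rw [← hl, Category.assoc, hρ, ← cancel_mono ι, Category.assoc, hr, Preadditive.comp_sub,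
        reassoc_of% hl', hl]
      simp
    have hsρ : s ≫ r' ≫ ρ' = 0 := by
      obtain ⟨l, hl⟩ := hκ.exists_lift s (by simp [s, hi.zero])
      have hl' : l ≫ κ' = 𝟙 A := by
        rw [← cancel_mono i, Category.assoc, hκ', reassoc_of% hl]
        simp [s]
      rw [← hl, Category.assoc, hρ, ← cancel_mono ι, Category.assoc, hr, Preadditive.comp_sub,
        reassoc_of% hl', hl]
      simp
    -- The extension of `r` is a retraction of `ι` vanishing on `s`, so the complementary section of
    -- `π` agrees with `s` on `A`.
    obtain ⟨t, ht, ht'⟩ := hπ.exists_section _ hιρ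
    refine ⟨⟨⟨t ≫ b', ?_, ?_⟩⟩⟩
    · have : i ≫ t = s := by
        have : i = s ≫ π := by simp [s]
        rw [this, Category.assoc, ht', Preadditive.comp_sub, ← Category.assoc, hsρ]
        simp
      rw [reassoc_of% this]
      simp [s]
    · rw [Category.assoc, hP.w, reassoc_of% ht]

variable (E) in
/-- The deflations with kernel `T`. -/
def deflationsWithKernel (T : C) : MorphismProperty C :=
  fun Z _ p => ∃ k : T ⟶ Z, E.IsConflation k p

lemma inflationsWithCokerIn_le_llp {S : ObjectProperty C} {T : C} (h : E.rightPerp S T) :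
    E.inflationsWithCokerIn S ≤ (E.deflationsWithKernel T).llp := by
  rintro A B i ⟨X, q, hX, hi⟩ Z X' p ⟨k, hp⟩
  exact hi.hasLiftingProperty hp (h X hX)

lemma rightPerp_antitone {S S' : ObjectProperty C} (h : S ≤ S') :
    E.rightPerp S' ≤ E.rightPerp S := fun _ hY X hX => hY X (h X hX)

variable [HasZeroObject C]

open ZeroObject

lemma ext1IsZero_iff_llp {X T : C} : E.Ext1IsZero X T ↔
    (E.deflationsWithKernel T).llp (0 : (0 : C) ⟶ X) := by
  constructor
  · rintro h Z X' p ⟨k, hp⟩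
    exact (isConflation_of_isZero (isZero_zero C) _).hasLiftingProperty hp h
  · intro h
    rw [ext1IsZero_iff]
    intro Z f g hc
    have := h g ⟨f, hc⟩
    have sq : CommSq (0 : (0 : C) ⟶ Z) (0 : (0 : C) ⟶ X) g (𝟙 X) := ⟨by simp⟩
    exact ⟨sq.lift, sq.fac_right⟩

/-- **Eklof's lemma**. -/
lemma rightPerp_le_rightPerp_filt (S : ObjectProperty C) :
    E.rightPerp S ≤ E.rightPerp (E.filt S) := by
  intro T hT X hX
  rw [ext1IsZero_iff_llp]
  -- A left lifting class is closed under transfinite composition, so only the individual steps of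
  -- the filtration have to be checked.
  exact MorphismProperty.transfiniteCompositions_le.{v} _ _
    (MorphismProperty.transfiniteCompositions_monotone.{v} (inflationsWithCokerIn_le_llp hT) _ hX)

/-- Both factors of `0 ⟶ G ⟶ P` lift against deflations with kernel `T`, hence so does their
composite. -/
lemma Ext1IsZero.extension {G P X T : C} {f : G ⟶ P} {g : P ⟶ X} (h : E.IsConflation f g)
    (hG : E.Ext1IsZero G T) (hX : E.Ext1IsZero X T) : E.Ext1IsZero P T := by
  rw [ext1IsZero_iff_llp] at hG ⊢
  have : (0 : (0 : C) ⟶ P) = 0 ≫ f := by simp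
  rw [this]
  refine MorphismProperty.comp_mem _ _ _ hG ?_
  rintro Z X' p ⟨k, hp⟩
  exact h.hasLiftingProperty hp hX

/-- Each coproduct injection is lifted separately, which avoids forming coproducts of conflations;
these need not exist. -/
lemma Ext1IsZero.cofan {K : Type*} {A : K → C} {c : Cofan A} (hc : IsColimit c) {T : C}
    (h : ∀ k, E.Ext1IsZero (A k) T) : E.Ext1IsZero c.pt T := by
  rw [ext1IsZero_iff]
  intro Z f g hfg
  have (k : K) : ∃ t : A k ⟶ Z, t ≫ g = c.inj k := by
    have := ext1IsZero_iff_llp.1 (h k) g ⟨f, hfg⟩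
    have sq : CommSq (0 : (0 : C) ⟶ Z) (0 : (0 : C) ⟶ A k) g (c.inj k) := ⟨by simp⟩
    exact ⟨sq.lift, sq.fac_right⟩
  choose t ht using this
  refine ⟨Cofan.IsColimit.desc hc t, Cofan.IsColimit.hom_ext hc _ _ fun k => ?_⟩
  rw [Cofan.IsColimit.fac_assoc, ht, Category.comp_id]

lemma Ext1IsZero.of_retract {X Y T : C} (i : X ⟶ Y) (r : Y ⟶ X) (hir : i ≫ r = 𝟙 X)
    (h : E.Ext1IsZero Y T) : E.Ext1IsZero X T := by
  rw [ext1IsZero_iff]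
  intro Z f g hfg
  have := ext1IsZero_iff_llp.1 h g ⟨f, hfg⟩
  have sq : CommSq (0 : (0 : C) ⟶ Z) (0 : (0 : C) ⟶ Y) g r := ⟨by simp⟩
  exact ⟨i ≫ sq.lift, by rw [Category.assoc, sq.fac_right, hir]⟩

end Ext

end ExactStructure

/-! ### Colimits over subsets of an ordered set -/

section IsColimitOn

variable {C : Type u} [Category.{v} C] {P : Type*} [Preorder P]

/-- The maps `ι` exhibit `Y` as the colimit of the restriction of `F` to the subset `s`. -/
structure IsColimitOn (F : P ⥤ C) (s : Set P) {Y : C} (ι : ∀ j ∈ s, F.obj j ⟶ Y) : Prop where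
  w : ∀ {i j : P} (hi : i ∈ s) (hj : j ∈ s) (h : i ≤ j), F.map (homOfLE h) ≫ ι j hj = ι i hi
  hom_ext : ∀ {Z : C} {f g : Y ⟶ Z}, (∀ j hj, ι j hj ≫ f = ι j hj ≫ g) → f = g
  exists_desc : ∀ {Z : C} (t : ∀ j ∈ s, F.obj j ⟶ Z),
    (∀ {i j : P} (hi : i ∈ s) (hj : j ∈ s) (h : i ≤ j), F.map (homOfLE h) ≫ t j hj = t i hi) →
      ∃ l : Y ⟶ Z, ∀ j hj, ι j hj ≫ l = t j hj

lemma IsColimitOn.of_isColimit {F : P ⥤ C} {c : Cocone F} (hc : IsColimit c) :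
    IsColimitOn F Set.univ (fun j _ => c.ι.app j) where
  w _ _ h := c.w (homOfLE h)
  hom_ext h := hc.hom_ext fun j => h j trivial
  exists_desc {Z} t ht :=
    ⟨hc.desc ⟨Z, { app := fun j => t j trivial
                   naturality := fun i j f => by
                    refine (ht (i := i) (j := j) trivial trivial (leOfHom f)).trans ?_
                    simp }⟩, fun j _ => hc.fac _ j⟩

lemma IsColimitOn.nonempty_isColimit {F : P ⥤ C} {c : Cocone F}
    (h : IsColimitOn F Set.univ (fun j _ => c.ι.app j)) : Nonempty (IsColimit c) := by
  have (s : Cocone F) := h.exists_desc (fun j _ => s.ι.app j) (fun _ _ h => s.w (homOfLE h))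
  choose d hd using this
  exact ⟨{ desc := d
           fac := fun s j => hd s j trivial
           uniq := fun s m hm => h.hom_ext fun j hj => by rw [hm, hd s j hj] }⟩

/-- Pushouts commute with colimits: a map out of `Y'` is a map out of `Y` and one out of `A'` that
agree on `A`. The least index `j₀` serves to read off the component on `A'`, which is then the same
at all stages. -/
lemma IsColimitOn.of_isPushout {F G : P ⥤ C} {s : Set P} {Y Y' : C}
    {ι : ∀ j ∈ s, F.obj j ⟶ Y} {ι' : ∀ j ∈ s, G.obj j ⟶ Y'} (h : IsColimitOn F s ι)
    (τ : ∀ j, F.obj j ⟶ G.obj j) {A A' : C} (u : A ⟶ A') (a : ∀ j, A ⟶ F.obj j)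
    (a' : ∀ j, A' ⟶ G.obj j) (b : A ⟶ Y) (b' : A' ⟶ Y') (τY : Y ⟶ Y')
    (hτ : ∀ j, IsPushout (a j) u (τ j) (a' j)) (hY : IsPushout b u τY b')
    (wτ : ∀ {i j : P} (hij : i ≤ j), F.map (homOfLE hij) ≫ τ j = τ i ≫ G.map (homOfLE hij))
    (wa' : ∀ {i j : P} (hij : i ≤ j), a' i ≫ G.map (homOfLE hij) = a' j)
    (wι : ∀ j hj, ι j hj ≫ τY = τ j ≫ ι' j hj) (wb : ∀ j hj, a j ≫ ι j hj = b)
    (wb' : ∀ j hj, a' j ≫ ι' j hj = b') {j₀ : P} (h₀ : j₀ ∈ s) (h₀' : ∀ j ∈ s, j₀ ≤ j) :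
    IsColimitOn G s ι' where
  w {i j} hi hj hij := (hτ i).hom_ext
    (by rw [← reassoc_of% (wτ hij), ← wι, ← wι, ← Category.assoc, h.w])
    (by rw [reassoc_of% (wa' hij), wb', wb'])
  hom_ext {Z f g} hfg := hY.hom_ext
    (h.hom_ext fun j hj => by
      rw [← Category.assoc, ← Category.assoc, wι, Category.assoc, Category.assoc, hfg])
    (by rw [← wb' j₀ h₀, Category.assoc, Category.assoc, hfg])
  exists_desc {Z} t ht := by
    obtain ⟨l, hl⟩ := h.exists_desc (fun j hj => τ j ≫ t j hj)
      (fun {i j} hi hj hij => by rw [reassoc_of% (wτ hij), ht hi hj hij])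
    refine ⟨hY.desc l (a' j₀ ≫ t j₀ h₀) ?_, fun j hj => (hτ j).hom_ext ?_ ?_⟩
    · rw [← wb j₀ h₀, Category.assoc, hl, reassoc_of% (hτ j₀).w]
    · rw [← Category.assoc, ← wι, Category.assoc, hY.inl_desc, hl]
    · rw [← Category.assoc, wb', hY.inr_desc, ← ht h₀ hj (h₀' j hj), reassoc_of% wa']

section

variable {J : Type*} [PartialOrder J] (F : J ⥤ C)

lemma IsColimitOn.of_isSuccLimit [F.IsWellOrderContinuous] {m : J} (hm : Order.IsSuccLimit m) :
    IsColimitOn F (Set.Iio m) (fun _ hj => F.map (homOfLE (Set.mem_Iio.1 hj).le)) where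
  w hi hj h := by rw [← F.map_comp]; rfl
  hom_ext {Z f g} h := (F.isColimitOfIsWellOrderContinuous m hm).hom_ext fun j => h j.1 j.2
  exists_desc {Z} t ht := by
    let c : Cocone ((Set.principalSegIio m).monotone.functor ⋙ F) :=
      ⟨Z, { app := fun j => t j.1 j.2
            naturality := fun i j f => by
              have := ht (i := i.1) (j := j.1) i.2 j.2 (leOfHom f)
              refine Eq.trans this ?_
              simp }⟩
    exact ⟨(F.isColimitOfIsWellOrderContinuous m hm).desc c, fun j hj =>
      (F.isColimitOfIsWellOrderContinuous m hm).fac c ⟨j, hj⟩⟩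

lemma isWellOrderContinuous_of_isColimitOn
    (h : ∀ m : J, Order.IsSuccLimit m →
      IsColimitOn F (Set.Iio m) (fun _ hj => F.map (homOfLE (Set.mem_Iio.1 hj).le))) :
    F.IsWellOrderContinuous where
  nonempty_isColimit m hm := by
    have (s : Cocone ((Set.principalSegIio m).monotone.functor ⋙ F)) :
        ∃ l : F.obj m ⟶ s.pt, ∀ (j : J) (hj : j < m),
          F.map (homOfLE hj.le) ≫ l = s.ι.app ⟨j, hj⟩ :=
      (h m hm).exists_desc (fun j hj => s.ι.app ⟨j, hj⟩)
        (fun {i j} hi hj hij => s.w (homOfLE hij : (⟨i, hi⟩ : Set.Iio m) ⟶ ⟨j, hj⟩))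
    choose d hd using this
    exact ⟨{ desc := d
             fac := fun s j => hd s j.1 j.2
             uniq := fun s l hl => (h m hm).hom_ext fun j hj => by
              rw [hd _ _ hj]; exact hl ⟨j, hj⟩ }⟩

end

end IsColimitOn

/-! ### Transfinite compositions of inflations -/

section Chains

namespace CategoryTheory.MorphismProperty

variable {C : Type u} [Category.{v} C] (W : MorphismProperty C)

instance : (transfiniteCompositions.{v} W).RespectsIso :=
  RespectsIso.of_respects_arrow_iso _ (by
    intro f f' e hf
    rw [transfiniteCompositions_iff] at hf ⊢
    obtain ⟨J, _, _, _, _, hf⟩ := hf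
    exact ⟨J, _, _, _, inferInstance,
      (arrow_mk_iso_iff (W.transfiniteCompositionsOfShape J) e).1 hf⟩)

variable {W} in
-- With a top index the value there is already the colimit, whether `⊤` is a limit or a successor.
lemma transfiniteCompositionsOfShape_of_top {J : Type*} [LinearOrder J] [SuccOrder J]
    [BoundedOrder J] [WellFoundedLT J] (F : J ⥤ C)
    (hF : ∀ m : J, Order.IsSuccLimit m →
      IsColimitOn F (Set.Iio m) (fun _ hj => F.map (homOfLE (Set.mem_Iio.1 hj).le)))
    (hW : ∀ j : J, ¬ IsMax j → W (F.map (homOfLE (Order.le_succ j)))) :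
    W.transfiniteCompositionsOfShape J (F.map (homOfLE (bot_le : (⊥ : J) ≤ ⊤))) :=
  ⟨{ F := F
     isoBot := Iso.refl _
     isWellOrderContinuous := isWellOrderContinuous_of_isColimitOn F hF
     incl := (coconeOfDiagramTerminal isTerminalTop F).ι
     isColimit := colimitOfDiagramTerminal isTerminalTop F
     fac := (Category.id_comp _).trans (by dsimp; congr 1)
     map_mem := hW }⟩

end CategoryTheory.MorphismProperty

namespace ExactStructure

variable {C : Type u} [Category.{v} C] [Preadditive C] {E : ExactStructure C}

lemma HasTransfiniteCompositions.isStableUnderTransfiniteComposition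
    (hcomp : E.HasTransfiniteCompositions) :
    MorphismProperty.IsStableUnderTransfiniteComposition.{v} E.inflations where
  isStableUnderTransfiniteCompositionOfShape J _ _ _ _ := by
    refine ⟨?_⟩
    rintro X Y f ⟨h⟩
    obtain ⟨c, ⟨hc⟩, hi⟩ := hcomp J h.F h.map_mem
    rw [← h.fac]
    refine (MorphismProperty.cancel_left_of_respectsIso E.inflations _ _).2 ?_
    have : h.incl.app ⊥ = c.ι.app ⊥ ≫ (hc.coconePointUniqueUpToIso h.isColimit).hom := by
      simp
    rw [this]
    exact (MorphismProperty.cancel_right_of_respectsIso E.inflations _ _).2 hi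

section

variable {W : MorphismProperty C} {J : Type v} [LinearOrder J] [SuccOrder J] [OrderBot J]
  [WellFoundedLT J]

/-- Transfinite compositions of inflations in a class stable under cobase change are stable under
cobase change. -/
lemma transfiniteCompositionsOfShape_of_isPushout (hcomp : E.HasTransfiniteCompositions)
    (hW : W ≤ E.inflations) [W.IsStableUnderCobaseChange] {A B A' B' : C} {f : A ⟶ B}
    {u : A ⟶ A'} {v : B ⟶ B'} {f' : A' ⟶ B'} (hP : IsPushout f u v f')
    (hf : W.transfiniteCompositionsOfShape J f) :
    W.transfiniteCompositionsOfShape J f' := by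
  obtain ⟨h⟩ := hf
  have := hcomp.isStableUnderTransfiniteComposition
  obtain ⟨a, ha⟩ : ∃ a : ∀ j, A ⟶ h.F.obj j,
      ∀ j, a j = h.isoBot.inv ≫ h.F.map (homOfLE bot_le) := ⟨_, fun _ => rfl⟩
  have hai (j : J) : E.inflations (a j) := by
    rw [ha]
    exact (MorphismProperty.cancel_left_of_respectsIso E.inflations _ _).2
      ((h.ofLE hW).mem_map _)
  have ha' {i j : J} (φ : i ⟶ j) : a i ≫ h.F.map φ = a j := by
    simp only [ha, Category.assoc, ← h.F.map_comp]
    rfl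
  -- Each partial composition `a j` is an inflation, so every stage can be pushed out along `u`.
  choose Q inl inr hQ hinr using fun j => E.pushout_inflation (a j) u (hai j)
  have hincl (j : J) : a j ≫ h.incl.app j = f := by
    have : h.F.map (homOfLE bot_le) ≫ h.incl.app j = h.incl.app ⊥ := by simp
    simp only [ha, Category.assoc, this, h.fac]
  obtain ⟨m, hm₁, hm₂⟩ : ∃ m : ∀ {i j : J} (_ : i ⟶ j), Q i ⟶ Q j,
      (∀ {i j : J} (φ : i ⟶ j), inl i ≫ m φ = h.F.map φ ≫ inl j) ∧
      (∀ {i j : J} (φ : i ⟶ j), inr i ≫ m φ = inr j) :=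
    ⟨fun {i j} φ => (hQ i).desc (h.F.map φ ≫ inl j) (inr j)
      (by rw [← Category.assoc, ha', (hQ j).w]), fun _ => by simp, fun _ => by simp⟩
  let G : J ⥤ C :=
    { obj := Q
      map := m
      map_id := fun j => (hQ j).hom_ext (by simp [hm₁]) (by simp [hm₂])
      map_comp := fun φ ψ => (hQ _).hom_ext (by simp [hm₁, reassoc_of% hm₁])
        (by simp [hm₂, reassoc_of% hm₂]) }
  -- By pasting, the squares between stages are pushouts too, so the successor steps stay in `W`.
  have hG {i j : J} (φ : i ⟶ j) : IsPushout (h.F.map φ) (inl i) (inl j) (G.map φ) := by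
    refine IsPushout.of_left ?_ (hm₁ φ).symm (hQ i)
    rw [ha', show inr i ≫ G.map φ = inr j from hm₂ φ]
    exact hQ j
  obtain ⟨ι, hι₁, hι₂⟩ : ∃ ι : ∀ j, Q j ⟶ B', (∀ j, inl j ≫ ι j = h.incl.app j ≫ v) ∧
      ∀ j, inr j ≫ ι j = f' :=
    ⟨fun j => (hQ j).desc (h.incl.app j ≫ v) f' (by rw [← Category.assoc, hincl, hP.w]),
      fun _ => by simp, fun _ => by simp⟩
  let incl : G ⟶ (Functor.const J).obj B' :=
    { app := ι
      naturality := fun i j φ => by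
        have : h.F.map φ ≫ h.incl.app j = h.incl.app i := by simp
        refine Eq.trans ?_ (Category.comp_id (ι i)).symm
        exact (hQ i).hom_ext
          ((Category.assoc _ _ _).symm.trans
            (by rw [show inl i ≫ G.map φ = _ from hm₁ φ, Category.assoc, hι₁, reassoc_of% this, hι₁]))
          ((Category.assoc _ _ _).symm.trans
            (by rw [show inr i ≫ G.map φ = _ from hm₂ φ, hι₂, hι₂])) }
  have : IsIso (inr ⊥) := by
    have : IsIso (a ⊥) := by
      have : h.F.map (homOfLE (bot_le : (⊥ : J) ≤ ⊥)) = 𝟙 _ := h.F.map_id _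
      rw [ha, this]
      infer_instance
    exact (hQ ⊥).isIso_inr_of_isIso
  have hcont : G.IsWellOrderContinuous := isWellOrderContinuous_of_isColimitOn _ fun k hk =>
    (IsColimitOn.of_isSuccLimit h.F hk).of_isPushout inl u a inr (a k) (inr k) (inl k) hQ
      (hQ k) (fun _ => (hm₁ _).symm) (fun _ => hm₂ _) (fun _ _ => (hm₁ _).symm)
      (fun _ _ => ha' _) (fun _ _ => hm₂ _) (j₀ := ⊥) hk.bot_lt (fun _ _ => bot_le)
  obtain ⟨hcol⟩ := IsColimitOn.nonempty_isColimit (c := ⟨B', incl⟩)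
    ((IsColimitOn.of_isColimit h.isColimit).of_isPushout (G := G)
      (ι' := fun j _ => ι j) inl u a inr f f' v hQ hP (fun _ => (hm₁ _).symm) (fun _ => hm₂ _)
      (fun j _ => (hι₁ j).symm) (fun j _ => hincl j) (fun j _ => hι₂ j)
      (j₀ := ⊥) trivial (fun _ _ => bot_le))
  exact ⟨{ F := G
           isoBot := (asIso (inr ⊥)).symm
           incl := incl
           isColimit := hcol
           fac := hι₂ ⊥
           map_mem := fun j hj => MorphismProperty.of_isPushout (hG _).flip (h.map_mem j hj) }⟩

end

lemma HasTransfiniteCompositions.isStableUnderCobaseChange (hcomp : E.HasTransfiniteCompositions)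
    {W : MorphismProperty C} (hW : W ≤ E.inflations) [W.IsStableUnderCobaseChange] :
    (MorphismProperty.transfiniteCompositions.{v} W).IsStableUnderCobaseChange where
  of_isPushout := by
    intro A A' B B' f g f' g' sq hg
    rw [MorphismProperty.transfiniteCompositions_iff] at hg ⊢
    obtain ⟨J, _, _, _, _, hg⟩ := hg
    exact ⟨J, _, _, _, inferInstance,
      transfiniteCompositionsOfShape_of_isPushout hcomp hW sq.flip hg⟩

lemma HasTransfiniteCompositions.transfiniteCompositions_le
    (hcomp : E.HasTransfiniteCompositions) {W : MorphismProperty C} (hW : W ≤ E.inflations) :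
    MorphismProperty.transfiniteCompositions.{v} W ≤ E.inflations := by
  have := hcomp.isStableUnderTransfiniteComposition
  rwa [MorphismProperty.transfiniteCompositions_le_iff]

end ExactStructure

end Chains

/-! ### Attaching cells -/

section CellAttachment

variable {C : Type u} [Category.{v} C] {K : Type*} {X : C} {A B : K → C}

/-- The result of attaching to `X` the cells `i k : A k ⟶ B k`, `k ∈ s`, along `f k : A k ⟶ X`. -/
structure CellAttachment (i : ∀ k, A k ⟶ B k) (f : ∀ k, A k ⟶ X) (s : Set K) where
  /-- the object with the cells attached -/
  pt : C
  /-- the inclusion of the base -/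
  base : X ⟶ pt
  /-- the inclusions of the cells -/
  cell : ∀ k ∈ s, B k ⟶ pt
  w : ∀ k hk, f k ≫ base = i k ≫ cell k hk
  hom_ext : ∀ {Z : C} {g h : pt ⟶ Z}, base ≫ g = base ≫ h →
    (∀ k hk, cell k hk ≫ g = cell k hk ≫ h) → g = h
  exists_desc : ∀ {Z : C} (b : X ⟶ Z) (c : ∀ k ∈ s, B k ⟶ Z),
    (∀ k hk, f k ≫ b = i k ≫ c k hk) →
      ∃ l : pt ⟶ Z, base ≫ l = b ∧ ∀ k hk, cell k hk ≫ l = c k hk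

namespace CellAttachment

variable {i : ∀ k, A k ⟶ B k} {f : ∀ k, A k ⟶ X}

section

variable {s t r : Set K} (a : CellAttachment i f s) (b : CellAttachment i f t)
  (c : CellAttachment i f r)

lemma exists_map (h : s ⊆ t) : ∃ l : a.pt ⟶ b.pt, a.base ≫ l = b.base ∧
    ∀ k hk, a.cell k hk ≫ l = b.cell k (h hk) :=
  a.exists_desc b.base (fun k hk => b.cell k (h hk)) fun k hk => b.w k (h hk)

/-- The comparison map when more cells are attached. -/
noncomputable def map (h : s ⊆ t) : a.pt ⟶ b.pt := (a.exists_map b h).choose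

lemma base_map (h : s ⊆ t) : a.base ≫ a.map b h = b.base := (a.exists_map b h).choose_spec.1

lemma base_map_assoc (h : s ⊆ t) {Z : C} (g : b.pt ⟶ Z) :
    a.base ≫ a.map b h ≫ g = b.base ≫ g := by
  rw [← Category.assoc, base_map]

lemma cell_map (h : s ⊆ t) {k : K} (hk : k ∈ s) :
    a.cell k hk ≫ a.map b h = b.cell k (h hk) := (a.exists_map b h).choose_spec.2 k hk

lemma cell_map_assoc (h : s ⊆ t) {k : K} (hk : k ∈ s) {Z : C} (g : b.pt ⟶ Z) :
    a.cell k hk ≫ a.map b h ≫ g = b.cell k (h hk) ≫ g := by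
  rw [← Category.assoc, cell_map]

lemma map_map (h : s ⊆ t) (h' : t ⊆ r) : a.map b h ≫ b.map c h' = a.map c (h.trans h') :=
  a.hom_ext (by simp only [base_map_assoc, base_map])
    (fun k hk => by simp only [cell_map_assoc, cell_map])

lemma map_self (h : s ⊆ s) : a.map a h = 𝟙 _ :=
  a.hom_ext (by simp [base_map]) (fun k hk => by simp [cell_map])

end

/-- Attaching no cells. -/
def empty (i : ∀ k, A k ⟶ B k) (f : ∀ k, A k ⟶ X) {s : Set K} (hs : s = ∅) :
    CellAttachment i f s where
  pt := X
  base := 𝟙 X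
  cell k hk := by subst hs; exact hk.elim
  w k hk := by subst hs; exact hk.elim
  hom_ext h _ := by simpa using h
  exists_desc b c _ := ⟨b, by simp, fun k hk => by subst hs; exact hk.elim⟩

/-- This is what makes each successor step of a cell-by-cell attachment a pushout of a single `i k`.
-/
lemma isPushout {s t : Set K} (a : CellAttachment i f s) (b : CellAttachment i f t) {k : K}
    (hk : k ∉ s) (ht : t = insert k s) :
    IsPushout (f k ≫ a.base) (i k) (a.map b (ht ▸ Set.subset_insert k s))
      (b.cell k (ht ▸ Set.mem_insert k s)) := by
  classical
  subst ht
  refine ⟨⟨by rw [Category.assoc, base_map, b.w]⟩, ⟨?_⟩⟩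
  have (c : PushoutCocone (f k ≫ a.base) (i k)) : ∃ l : b.pt ⟶ c.pt,
      a.map b (Set.subset_insert k s) ≫ l = c.inl ∧
      b.cell k (Set.mem_insert k s) ≫ l = c.inr := by
    obtain ⟨l, h₁, h₂⟩ := b.exists_desc (a.base ≫ c.inl)
      (fun j hj => if h : j = k then eqToHom (by rw [h]) ≫ c.inr else
        a.cell j (Set.mem_of_mem_insert_of_ne hj h) ≫ c.inl) (fun j hj => by
          split_ifs with h
          · subst h
            simpa using c.condition
          · simpa using a.w j (Set.mem_of_mem_insert_of_ne hj h) =≫ c.inl)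
    refine ⟨l, a.hom_ext (by rw [base_map_assoc, h₁]) (fun j hj => ?_), by rw [h₂]; simp⟩
    rw [cell_map_assoc, h₂, dif_neg]
    rintro rfl
    exact hk hj
  choose l hl hl' using this
  refine PushoutCocone.IsColimit.mk _ l hl hl' fun c m h₁ h₂ => b.hom_ext ?_ ?_
  · rw [← a.base_map_assoc b (Set.subset_insert k s), h₁,
      ← a.base_map_assoc b (Set.subset_insert k s), hl]
  · rintro j (rfl | hj)
    · rw [h₂, hl']
    · rw [← a.cell_map_assoc b (Set.subset_insert k s) hj, h₁,
        ← a.cell_map_assoc b (Set.subset_insert k s) hj, hl]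

/-- Attaching one more cell. -/
lemma nonempty_insert {s t : Set K} (a : CellAttachment i f s) {k : K} (hk : k ∉ s)
    (ht : t = insert k s) {Q : C} {g : a.pt ⟶ Q} {h : B k ⟶ Q}
    (hP : IsPushout (f k ≫ a.base) (i k) g h) : Nonempty (CellAttachment i f t) := by
  classical
  subst ht
  refine ⟨{ pt := Q
            base := a.base ≫ g
            cell := fun j hj => if e : j = k then eqToHom (by rw [e]) ≫ h else
              a.cell j (Set.mem_of_mem_insert_of_ne hj e) ≫ g
            w := fun j hj => ?_
            hom_ext := fun {Z x y} h₁ h₂ => hP.hom_ext (a.hom_ext ?_ fun j hj => ?_) ?_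
            exists_desc := fun {Z} b c hbc => ?_ }⟩
  · split_ifs with e
    · subst e
      simpa using hP.w
    · rw [← Category.assoc, ← Category.assoc, a.w]
  · simpa using h₁
  · have e : j ≠ k := by
      rintro rfl
      exact hk hj
    simpa [e] using h₂ j (Or.inr hj)
  · simpa using h₂ k (Or.inl rfl)
  · obtain ⟨l, h₁, h₂⟩ := a.exists_desc b (fun j hj => c j (Or.inr hj))
      (fun j hj => hbc j (Or.inr hj))
    refine ⟨hP.desc l (c k (Or.inl rfl)) (by rw [Category.assoc, h₁, hbc k (Or.inl rfl)]), by simp [h₁], ?_⟩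
    intro j hj
    split_ifs with e
    · subst e
      simp
    · simp [h₂]

section

variable {P : Type*} [LinearOrder P] {σ : P → Set K} (hσ : Monotone σ)
  (a : ∀ p, CellAttachment i f (σ p))

/-- The functor given by cells attached successively. -/
noncomputable def functor : P ⥤ C where
  obj p := (a p).pt
  map φ := (a _).map (a _) (hσ (leOfHom φ))
  map_id _ := map_self _ _
  map_comp _ _ := (map_map _ _ _ _ _).symm

section

variable {S : Set P} {Z : C} {τ : ∀ p ∈ S, (a p).pt ⟶ Z}
  (hτ : ∀ {p q : P} (hp : p ∈ S) (hq : q ∈ S) (h : p ≤ q),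
    (a p).map (a q) (hσ h) ≫ τ q hq = τ p hp)

include hτ

lemma base_comp_eq {p q : P} (hp : p ∈ S) (hq : q ∈ S) :
    (a p).base ≫ τ p hp = (a q).base ≫ τ q hq := by
  rcases le_total p q with h | h
  · rw [← hτ hp hq h, base_map_assoc]
  · rw [← hτ hq hp h, base_map_assoc]

lemma cell_comp_eq {p q : P} (hp : p ∈ S) (hq : q ∈ S) {k : K} (hk : k ∈ σ p) (hk' : k ∈ σ q) :
    (a p).cell k hk ≫ τ p hp = (a q).cell k hk' ≫ τ q hq := by
  rcases le_total p q with h | h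
  · rw [← hτ hp hq h, cell_map_assoc]
  · rw [← hτ hq hp h, cell_map_assoc]

end

variable {S : Set P} {t : Set K}

/-- Each cell of `t` appears at some stage, and compatible maps on the stages agree on a common cell
because the stages are linearly ordered. -/
lemma isColimitOn (hS : S.Nonempty) (b : CellAttachment i f t)
    (h : ∀ p ∈ S, σ p ⊆ t) (h' : ∀ k ∈ t, ∃ p ∈ S, k ∈ σ p) :
    IsColimitOn (functor hσ a) S (fun p hp => (a p).map b (h p hp)) where
  w hi hj hij := map_map _ _ _ _ _
  hom_ext {Z g g'} hg := by
    replace hg : ∀ p hp, (a p).map b (h p hp) ≫ g = (a p).map b (h p hp) ≫ g' := hg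
    refine b.hom_ext ?_ fun k hk => ?_
    · obtain ⟨p, hp⟩ := hS
      rw [← (a p).base_map_assoc b (h p hp), hg p hp, base_map_assoc]
    · obtain ⟨p, hp, hkp⟩ := h' k hk
      rw [← (a p).cell_map_assoc b (h p hp) hkp, hg p hp, cell_map_assoc]
  exists_desc {Z} (τ : ∀ p ∈ S, (a p).pt ⟶ Z) hτ := by
    replace hτ : ∀ {p q : P} (hp : p ∈ S) (hq : q ∈ S) (h : p ≤ q),
      (a p).map (a q) (hσ h) ≫ τ q hq = τ p hp := hτ
    obtain ⟨p₀, hp₀⟩ := hS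
    choose p hp hkp using h'
    obtain ⟨l, h₁, h₂⟩ := b.exists_desc ((a p₀).base ≫ τ p₀ hp₀)
      (fun k hk => (a (p k hk)).cell k (hkp k hk) ≫ τ (p k hk) (hp k hk))
      (fun k hk => by
        rw [base_comp_eq hσ a hτ hp₀ (hp k hk), ← Category.assoc, ← Category.assoc,
          (a (p k hk)).w])
    refine ⟨l, fun q hq => ?_⟩
    change (a q).map b _ ≫ l = τ q hq
    refine (a q).hom_ext ?_ fun k hk => ?_
    · rw [base_map_assoc, h₁, base_comp_eq hσ a hτ]
    · rw [cell_map_assoc, h₂, cell_comp_eq hσ a hτ]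

/-- Needed at limit stages: the axiom on transfinite compositions provides some colimit, which is
recognised here as an attachment of the union of the cells. -/
lemma nonempty_of_isColimitOn (hS : S.Nonempty) {Y : C} {ι : ∀ p ∈ S, (a p).pt ⟶ Y}
    (hι : IsColimitOn (functor hσ a) S ι) (h : ∀ p ∈ S, σ p ⊆ t)
    (h' : ∀ k ∈ t, ∃ p ∈ S, k ∈ σ p) : Nonempty (CellAttachment i f t) := by
  have hι' : ∀ {p q : P} (hp : p ∈ S) (hq : q ∈ S) (h : p ≤ q),
    (a p).map (a q) (hσ h) ≫ ι q hq = ι p hp := hι.w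
  have hext {Z : C} {f g : Y ⟶ Z} (H : ∀ p hp, ι p hp ≫ f = ι p hp ≫ g) : f = g := hι.hom_ext H
  have hdesc {Z : C} (τ : ∀ p ∈ S, (a p).pt ⟶ Z)
    (hτ : ∀ {p q : P} (hp : p ∈ S) (hq : q ∈ S) (h : p ≤ q),
      (a p).map (a q) (hσ h) ≫ τ q hq = τ p hp) :
    ∃ l : Y ⟶ Z, ∀ p hp, ι p hp ≫ l = τ p hp := hι.exists_desc τ hτ
  obtain ⟨p₀, hp₀⟩ := hS
  choose p hp hkp using h'
  refine ⟨{ pt := Y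
            base := (a p₀).base ≫ ι p₀ hp₀
            cell := fun k hk => (a (p k hk)).cell k (hkp k hk) ≫ ι (p k hk) (hp k hk)
            w := fun k hk => ?_
            hom_ext := fun {Z x y} h₁ h₂ =>
              hext fun q hq => (a q).hom_ext ?_ fun k hk => ?_
            exists_desc := fun {Z} b c hbc => ?_ }⟩
  · rw [base_comp_eq hσ a hι' hp₀ (hp k hk), ← Category.assoc, ← Category.assoc, (a _).w]
  · rw [base_comp_eq hσ a hι' hp₀ hq] at h₁
    simpa using h₁
  · have := h₂ k (h q hq hk)
    rw [cell_comp_eq hσ a hι' (hp k _) hq _ hk] at this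
    simpa using this
  · choose l h₁ h₂ using fun q => (a q).exists_desc (Z := Z)
    obtain ⟨l', hl'⟩ := hdesc
      (fun q hq => l q b (fun k hk => c k (h q hq hk)) (fun k hk => hbc k _))
      (fun {q r} hq hr hqr => (a q).hom_ext (by rw [base_map_assoc, h₁, h₁])
        (fun k hk => by rw [cell_map_assoc, h₂, h₂]))
    refine ⟨l', by rw [Category.assoc, hl', h₁], fun k hk => by rw [Category.assoc, hl', h₂]⟩

end

end CellAttachment

end CellAttachment

namespace ExactStructure

variable {C : Type u} [Category.{v} C] [Preadditive C] {E : ExactStructure C}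

/-- A set of cells in a class of inflations which is stable under cobase change can be attached,
and the result is a transfinite composition of maps in this class. -/
lemma HasTransfiniteCompositions.exists_cellAttachment (hcomp : E.HasTransfiniteCompositions)
    {W : MorphismProperty C} (hW : W ≤ E.inflations) [W.IsStableUnderCobaseChange]
    {K : Type v} {X : C} {A B : K → C} (i : ∀ k, A k ⟶ B k) (f : ∀ k, A k ⟶ X)
    (hi : ∀ k, W (i k)) :
    ∃ a : CellAttachment i f Set.univ, MorphismProperty.transfiniteCompositions.{v} W a.base := by
  -- The cells are attached along a well-order of `K`. The inequality defining `σ` is strict, so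
  -- that limit stages are unions; the added top makes the last stage contain every cell.
  obtain ⟨_, _⟩ := exists_wellFoundedLT K
  let : OrderBot (WithTop K) := WellFoundedLT.toOrderBot _
  let : BoundedOrder (WithTop K) := { }
  let : SuccOrder (WithTop K) := SuccOrder.ofLinearWellFoundedLT _
  let σ (p : WithTop K) : Set K := { k | (k : WithTop K) < p }
  have hσ : Monotone σ := fun p q hpq k hk => lt_of_lt_of_le hk hpq
  have hbot : σ ⊥ = ∅ := Set.eq_empty_of_forall_notMem fun k hk =>
    not_lt_bot (show (k : WithTop K) < ⊥ from hk)
  have hmax (p : WithTop K) (hp : ¬ IsMax p) : ∃ k : K, p = k ∧ k ∉ σ p ∧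
      σ (Order.succ p) = insert k (σ p) := by
    have hp' : p ≠ ⊤ := fun h => hp (h ▸ isMax_top)
    lift p to K using hp'
    refine ⟨p, rfl, fun h => lt_irrefl (p : WithTop K) h, Set.ext fun k => ?_⟩
    change (k : WithTop K) < _ ↔ k = p ∨ (k : WithTop K) < _
    rw [Order.lt_succ_iff_of_not_isMax hp, le_iff_eq_or_lt, WithTop.coe_inj]
  have hlim {p : WithTop K} (hp : Order.IsSuccLimit p) {k : K} (hk : k ∈ σ p) :
      ∃ q < p, k ∈ σ q :=
    ⟨Order.succ (k : WithTop K), hp.succ_lt hk, Order.lt_succ_of_not_isMax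
      (not_isMax_iff.2 ⟨⊤, WithTop.coe_lt_top k⟩)⟩
  have step {s t : Set K} (a : CellAttachment i f s) (b : CellAttachment i f t) {k : K}
      (hk : k ∉ s) (ht : t = insert k s) (h : s ⊆ t) : W (a.map b h) :=
    MorphismProperty.of_isPushout (a.isPushout b hk ht) (hi k)
  have key (p : WithTop K) : Nonempty (CellAttachment i f (σ p)) := by
    induction p using SuccOrder.limitRecOn with
    | isMin p hp => exact ⟨.empty i f (hp.eq_bot ▸ hbot)⟩
    | succ p hp ih =>
      obtain ⟨a⟩ := ih
      obtain ⟨k, -, hk, hs⟩ := hmax p hp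
      obtain ⟨Q, g, h, hP, -⟩ := E.pushout_inflation (i k) (f k ≫ a.base) (hW _ (hi k))
      exact a.nonempty_insert hk hs hP.flip
    | isSuccLimit p hp ih =>
      -- Arbitrary choices of the earlier stages still form a functor, because the comparison maps
      -- are forced by the universal property.
      let a (q : Set.Iio p) : CellAttachment i f (σ q) := (ih q.1 q.2).some
      let : OrderBot (Set.Iio p) := { bot := ⟨⊥, hp.bot_lt⟩, bot_le := fun q => bot_le (a := q.1) }
      have hσ' : Monotone (fun q : Set.Iio p => σ q) := fun _ _ h => hσ h
      let F := CellAttachment.functor hσ' a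
      have hF : F.IsWellOrderContinuous := isWellOrderContinuous_of_isColimitOn _ fun m hm =>
        CellAttachment.isColimitOn hσ' a ⟨⊥, hm.bot_lt⟩ (a m) (fun q hq => hσ (le_of_lt hq))
          fun k hk => by
            have hlt : (⟨k, lt_trans (show (k : WithTop K) < m.1 from hk) m.2⟩ : Set.Iio p) < m :=
              hk
            have hk' : ¬ IsMax (k : WithTop K) := not_isMax_iff.2 ⟨_, hk⟩
            refine ⟨_, hm.succ_lt hlt, ?_⟩
            change (k : WithTop K) < _
            rw [coe_succ_of_mem (Set.mem_Iio.2 (hp.succ_lt (lt_trans hk m.2)))]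
            exact Order.lt_succ_of_not_isMax hk'
      obtain ⟨c, ⟨hc⟩, -⟩ := hcomp (Set.Iio p) F fun q hq => by
        obtain ⟨k, -, hk, hs⟩ := hmax q.1 (not_isMax_iff.2 ⟨p, q.2⟩)
        refine hW _ (step (a q) (a (Order.succ q)) hk ?_ _)
        rw [← hs, coe_succ_of_mem (Set.mem_Iio.2 (hp.succ_lt q.2))]
      exact CellAttachment.nonempty_of_isColimitOn hσ' a (S := Set.univ) ⟨⊥, trivial⟩
        (IsColimitOn.of_isColimit hc) (fun q _ => hσ (le_of_lt q.2)) fun k hk => by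
          obtain ⟨q, hqp, hq⟩ := hlim hp hk
          exact ⟨⟨q, hqp⟩, trivial, hq⟩
  have htop : σ ⊤ = Set.univ := Set.eq_univ_of_forall fun k => WithTop.coe_lt_top k
  let a (p : WithTop K) : CellAttachment i f (σ p) := (key p).some
  have hext (t : Set K) (ht : σ ⊤ = t) : ∃ b : CellAttachment i f t,
      ∀ h, MorphismProperty.transfiniteCompositions.{v} W ((a ⊥).map b h) := by
    subst ht
    refine ⟨a ⊤, fun _ => MorphismProperty.transfiniteCompositionsOfShape_le_transfiniteCompositions
      _ (WithTop K) _ (MorphismProperty.transfiniteCompositionsOfShape_of_top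
        (CellAttachment.functor hσ a) (fun m hm => ?_) fun p hp => ?_)⟩
    · exact CellAttachment.isColimitOn hσ a ⟨⊥, hm.bot_lt⟩ (a m) (fun q hq => hσ (le_of_lt hq))
        fun k hk => hlim hm hk
    · obtain ⟨k, -, hk, hs⟩ := hmax p hp
      exact step _ _ hk hs _
  obtain ⟨b, hb⟩ := hext _ htop
  refine ⟨b, ?_⟩
  -- No cell lies below `⊥`, so the bottom stage is `X` up to isomorphism.
  have hiso : IsIso (a ⊥).base := by
    obtain ⟨l, hl, -⟩ := (a ⊥).exists_desc (𝟙 X) (fun k hk => (hbot ▸ hk : k ∈ (∅ : Set K)).elim)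
      (fun k hk => (hbot ▸ hk : k ∈ (∅ : Set K)).elim)
    exact ⟨l, hl, (a ⊥).hom_ext (by simp [reassoc_of% hl])
      (fun k hk => (hbot ▸ hk : k ∈ (∅ : Set K)).elim)⟩
  rw [← (a ⊥).base_map b (Set.subset_univ _)]
  exact (MorphismProperty.cancel_left_of_respectsIso _ _ _).2 (hb _)

end ExactStructure

/-! ### Transfinite compositions as towers of subobjects -/

section Towers

variable {C : Type u} [Category.{v} C] {N : C}

open Subobject

lemma underlying_map_arrow {x y : Subobject N} (h : x ≤ y) :
    underlying.map (homOfLE h) ≫ y.arrow = x.arrow := underlying_arrow (homOfLE h)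

/-- The conclusion that `x` is reached in `Φ` by a successor or a limit step. -/
def IsTowerStep (W : MorphismProperty C) (Φ : Set (Subobject N)) (x : Subobject N) : Prop :=
  (∃ y ∈ Φ, ∃ h : y < x, (∀ z ∈ Φ, z < x → z ≤ y) ∧ W (underlying.map (homOfLE h.le))) ∨
  ((∃ y ∈ Φ, y < x) ∧ IsColimitOn underlying {y | y ∈ Φ ∧ y < x}
    (fun _ hy => underlying.map (homOfLE hy.2.le)))

/-- `Φ` is a well-ordered set of subobjects of `N`, leading from `a` to `b`, in which the successor
steps belong to `W` and the limit steps are colimits. -/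
structure IsTower (W : MorphismProperty C) (Φ : Set (Subobject N)) (a b : Subobject N) : Prop where
  small : Small.{v} Φ
  left_mem : a ∈ Φ
  right_mem : b ∈ Φ
  left_le : ∀ x ∈ Φ, a ≤ x
  le_right : ∀ x ∈ Φ, x ≤ b
  exists_least : ∀ s ⊆ Φ, s.Nonempty → ∃ x ∈ s, ∀ y ∈ s, x ≤ y
  step : ∀ x ∈ Φ, x ≠ a → IsTowerStep W Φ x

lemma IsTower.total {W : MorphismProperty C} {Φ : Set (Subobject N)} {a b : Subobject N}
    (h : IsTower W Φ a b) {x y : Subobject N} (hx : x ∈ Φ) (hy : y ∈ Φ) : x ≤ y ∨ y ≤ x := by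
  obtain ⟨z, rfl | rfl, hz⟩ := h.exists_least {x, y} (by rintro z (rfl | rfl) <;> assumption)
    ⟨x, by simp⟩
  · exact Or.inl (hz _ (by simp))
  · exact Or.inr (hz _ (by simp))

/-- Transports a colimit from a chain to the subobjects it represents. Since `σ` need not be
injective, the new index set is the image `σ '' t`. -/
lemma IsColimitOn.subobject {J : Type*} [LinearOrder J] {F : J ⥤ C} {t : Set J} {Y : C}
    {ι : ∀ j ∈ t, F.obj j ⟶ Y} (hι : IsColimitOn F t ι) {σ : J → Subobject N} (hσ : Monotone σ)
    (e : ∀ j, (σ j : C) ≅ F.obj j)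
    (he : ∀ {i j : J} (h : i ≤ j), underlying.map (homOfLE (hσ h)) ≫ (e j).hom =
      (e i).hom ≫ F.map (homOfLE h))
    {x : Subobject N} (ex : (x : C) ≅ Y) (hx : ∀ j ∈ t, σ j ≤ x)
    (hex : ∀ j hj, underlying.map (homOfLE (hx j hj)) ≫ ex.hom = (e j).hom ≫ ι j hj)
    {s : Set (Subobject N)} (hs : s = σ '' t) (hs' : ∀ y ∈ s, y ≤ x) :
    IsColimitOn underlying s (fun y hy => underlying.map (homOfLE (hs' y hy))) where
  w hi hj h := by rw [← Functor.map_comp]; rfl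
  hom_ext {Z f g} hfg := by
    rw [← cancel_epi ex.inv]
    refine hι.hom_ext fun j hj => ?_
    have h := hfg (σ j) (hs ▸ ⟨j, hj, rfl⟩)
    have h' : ι j hj ≫ ex.inv = (e j).inv ≫ underlying.map (homOfLE (hx j hj)) := by
      rw [Iso.eq_inv_comp, ← Category.assoc, Iso.comp_inv_eq, hex]
    rw [reassoc_of% h', h, ← reassoc_of% h']
  exists_desc {Z} τ hτ := by
    have hmem (j : J) (hj : j ∈ t) : σ j ∈ s := hs ▸ ⟨j, hj, rfl⟩
    obtain ⟨l, hl⟩ := hι.exists_desc (fun j hj => (e j).inv ≫ τ (σ j) (hmem j hj))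
      (fun {i j} hi hj h => by
        rw [← hτ (hmem i hi) (hmem j hj) (hσ h), Iso.eq_inv_comp, ← reassoc_of% (he h),
          Iso.hom_inv_id_assoc])
    refine ⟨ex.hom ≫ l, fun y hy => ?_⟩
    obtain ⟨j, hj, rfl⟩ : y ∈ σ '' t := hs ▸ hy
    rw [reassoc_of% (hex j hj), hl, Iso.hom_inv_id_assoc]

end Towers

namespace ExactStructure

variable {C : Type u} [Category.{v} C] [Preadditive C] {E : ExactStructure C}
  {W : MorphismProperty C} {N : C}

open Subobject

/-- The stages of a transfinite composition of inflations map to the colimit by monomorphisms, so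
they may be replaced by subobjects of `N`; isomorphic consecutive stages are thereby identified. -/
lemma HasTransfiniteCompositions.exists_isTower (hcomp : E.HasTransfiniteCompositions)
    (hW : W ≤ E.inflations) [W.RespectsIso] {a b : Subobject N} (hab : a ≤ b)
    (h : MorphismProperty.transfiniteCompositions.{v} W (underlying.map (homOfLE hab))) :
    ∃ Φ, IsTower W Φ a b := by
  rw [MorphismProperty.transfiniteCompositions_iff] at h
  obtain ⟨J, _, _, _, _, ⟨h⟩⟩ := h
  have := hcomp.isStableUnderTransfiniteComposition
  have hmono (j : J) : Mono (h.incl.app j) := inflations_mono ((h.ofLE hW).mem_incl_app j)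
  have hmono' (j : J) : Mono (h.incl.app j ≫ b.arrow) :=
    mono_comp' (hmono j) inferInstance
  have hw {i j : J} (hij : i ≤ j) : h.F.map (homOfLE hij) ≫ h.incl.app j = h.incl.app i := by simp
  let σ (j : J) : Subobject N := Subobject.mk (h.incl.app j ≫ b.arrow)
  have hσ : Monotone σ := fun i j hij =>
    mk_le_mk_of_comm (h.F.map (homOfLE hij)) (by rw [← Category.assoc, hw])
  have hσb (j : J) : σ j ≤ b := mk_le_of_comm (h.incl.app j) rfl
  have hbot : σ ⊥ = a := by
    have e : h.isoBot.hom ≫ a.arrow = h.incl.app ⊥ ≫ b.arrow := by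
      have hfac := h.fac
      rw [Iso.inv_comp_eq] at hfac
      rw [hfac, Category.assoc, underlying_map_arrow]
    refine le_antisymm (mk_le_of_comm h.isoBot.hom e) (le_mk_of_comm h.isoBot.inv ?_)
    rw [← e, Iso.inv_hom_id_assoc]
  let e (j : J) : (σ j : C) ≅ h.F.obj j := underlyingIso _
  have he' (j : J) : (e j).hom ≫ h.incl.app j ≫ b.arrow = (σ j).arrow :=
    underlyingIso_hom_comp_eq_mk _
  have he {i j : J} (hij : i ≤ j) : underlying.map (homOfLE (hσ hij)) ≫ (e j).hom =
      (e i).hom ≫ h.F.map (homOfLE hij) := by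
    rw [← cancel_mono (h.incl.app j ≫ b.arrow), Category.assoc, Category.assoc, he',
      underlying_map_arrow, ← Category.assoc (h.F.map _), hw, he']
  have hlt {i j : J} (hij : σ i < σ j) : i < j := lt_of_not_ge fun h => hij.not_ge (hσ h)
  refine ⟨insert b (Set.range σ), ⟨?_, ?_, ?_, ?_, ?_, ?_, ?_⟩⟩
  · infer_instance
  · exact Or.inr ⟨⊥, hbot⟩
  · exact Or.inl rfl
  · rintro x (rfl | ⟨j, rfl⟩)
    · exact hab
    · exact hbot ▸ hσ bot_le
  · rintro x (rfl | ⟨j, rfl⟩)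
    · exact le_rfl
    · exact hσb j
  · intro s hs hs'
    by_cases hj : ∃ j, σ j ∈ s
    · obtain ⟨j, hj, hmin⟩ := WellFounded.has_min wellFounded_lt {j | σ j ∈ s} hj
      refine ⟨σ j, hj, fun y hy => ?_⟩
      obtain rfl | ⟨i, rfl⟩ := hs hy
      · exact hσb j
      · exact hσ (le_of_not_gt (hmin i hy))
    · have hb (y : Subobject N) (hy : y ∈ s) : y = b := by
        obtain rfl | ⟨i, rfl⟩ := hs hy
        · rfl
        · exact (hj ⟨i, hy⟩).elim
      obtain ⟨y, hy⟩ := hs'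
      exact ⟨y, hy, fun z hz => by rw [hb y hy, hb z hz]⟩
  · intro x hx hxa
    by_cases hxσ : ∃ j, σ j = x
    · obtain ⟨j, hj, hmin⟩ := WellFounded.has_min wellFounded_lt {j | σ j = x} hxσ
      obtain rfl : σ j = x := hj
      have hlt' {i : J} (hij : i < j) : σ i < σ j :=
        lt_of_le_of_ne (hσ hij.le) fun h => hmin i h hij
      induction j using SuccOrder.limitRecOn with
      | isMin j hj' => exact (hxa (hj'.eq_bot ▸ hbot)).elim
      | succ j hj' =>
        refine Or.inl ⟨σ j, Or.inr ⟨j, rfl⟩, hlt' (Order.lt_succ_of_not_isMax hj'), ?_, ?_⟩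
        · rintro z (rfl | ⟨i, rfl⟩) hz
          · exact (hz.not_ge (hσb _)).elim
          · exact hσ ((Order.lt_succ_iff_of_not_isMax hj').1 (hlt hz))
        · refine (MorphismProperty.arrow_mk_iso_iff W (Arrow.isoMk (e j) (e _) ?_)).2
            (h.map_mem j hj')
          exact (he (Order.le_succ j)).symm
      | isSuccLimit j hj' =>
        refine Or.inr ⟨⟨a, Or.inr ⟨⊥, hbot⟩, hbot ▸ hlt' hj'.bot_lt⟩, ?_⟩
        refine (IsColimitOn.of_isSuccLimit h.F hj').subobject hσ e he (e j)
          (fun i hi => hσ (le_of_lt hi)) (fun i hi => he (le_of_lt hi)) ?_ _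
        ext y
        constructor
        · rintro ⟨rfl | ⟨i, rfl⟩, hy⟩
          · exact (hy.not_ge (hσb _)).elim
          · exact ⟨i, hlt hy, rfl⟩
        · rintro ⟨i, hi, rfl⟩
          exact ⟨Or.inr ⟨i, rfl⟩, hlt' hi⟩
    -- Here the endpoint is not attained at any stage, so it is the colimit of all of them.
    · obtain rfl : x = b := hx.resolve_right hxσ
      have hlt' (j : J) : σ j < x := lt_of_le_of_ne (hσb j) fun h => hxσ ⟨j, h⟩
      refine Or.inr ⟨⟨a, Or.inr ⟨⊥, hbot⟩, lt_of_le_of_ne hab hxa.symm⟩, ?_⟩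
      refine (IsColimitOn.of_isColimit h.isColimit).subobject hσ e he (Iso.refl _)
        (fun i _ => hσb i) (fun i _ => ?_) ?_ _
      · rw [← cancel_mono x.arrow]
        simp only [Iso.refl_hom, Category.comp_id, underlying_map_arrow, Category.assoc]
        exact (he' i).symm
      · ext y
        constructor
        · rintro ⟨rfl | ⟨i, rfl⟩, hy⟩
          · exact (lt_irrefl _ hy).elim
          · exact ⟨i, trivial, rfl⟩
        · rintro ⟨i, hi, rfl⟩
          exact ⟨Or.inr ⟨i, rfl⟩, hlt' i⟩

end ExactStructure

section Towers

variable {C : Type u} [Category.{v} C] {N : C} {W : MorphismProperty C}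

open Subobject

lemma IsTower.transfiniteCompositions {Φ : Set (Subobject N)} {a b : Subobject N}
    (h : IsTower W Φ a b) (hab : a ≤ b) :
    MorphismProperty.transfiniteCompositions.{v} W (underlying.map (homOfLE hab)) := by
  classical
  have := h.small
  let : LinearOrder Φ :=
    { (inferInstance : PartialOrder Φ) with
      le_total := fun x y => h.total x.2 y.2
      toDecidableLE := Classical.decRel _ }
  have : WellFoundedLT Φ := ⟨WellFounded.wellFounded_iff_has_min.2 fun s hs => by
    obtain ⟨x, ⟨x, hx, rfl⟩, hmin⟩ := h.exists_least (Subtype.val '' s)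
      (by rintro _ ⟨x, -, rfl⟩; exact x.2) (hs.image _)
    exact ⟨x, hx, fun y hy => not_lt_of_ge (hmin y ⟨y, hy, rfl⟩)⟩⟩
  let : BoundedOrder Φ :=
    { bot := ⟨a, h.left_mem⟩
      bot_le := fun x => h.left_le x x.2
      top := ⟨b, h.right_mem⟩
      le_top := fun x => h.le_right x x.2 }
  let : SuccOrder Φ := SuccOrder.ofLinearWellFoundedLT _
  let F : Φ ⥤ C := (Subtype.mono_coe (· ∈ Φ)).functor ⋙ underlying
  have key : W.transfiniteCompositionsOfShape Φ (F.map (homOfLE (bot_le : (⊥ : Φ) ≤ ⊤))) := by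
    refine MorphismProperty.transfiniteCompositionsOfShape_of_top F (fun m hm => ?_)
      (fun j hj => ?_)
    -- At a limit index a largest predecessor `y` is impossible, since the successor of `y` would
    -- still lie below `m`.
    · obtain ⟨y, hy, hym, hmax, -⟩ | ⟨-, hcol⟩ :=
        h.step m m.2 (fun e => hm.bot_lt.ne (Subtype.ext e.symm))
      · have hlt : (⟨y, hy⟩ : Φ) < m := hym
        exact ((Order.lt_succ_of_not_isMax (not_isMax_iff.2 ⟨m, hlt⟩)).not_ge
          (hmax _ (Subtype.prop _) (hm.succ_lt hlt))).elim
      · exact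
        { w := fun hi hj hij => by rw [← Functor.map_comp]; rfl
          hom_ext := fun H => hcol.hom_ext fun j hj => H ⟨j, hj.1⟩ hj.2
          exists_desc := fun t ht => by
            obtain ⟨l, hl⟩ := hcol.exists_desc (fun j hj => t ⟨j, hj.1⟩ hj.2)
              (fun {i j} hi hj hij => ht (i := ⟨i, hi.1⟩) (j := ⟨j, hj.1⟩) hi.2 hj.2 hij)
            exact ⟨l, fun j hj => hl j ⟨j.2, hj⟩⟩ }
    · have hlt := Order.lt_succ_of_not_isMax hj
      have hle {y : Φ} (hy : y < Order.succ j) : y ≤ j := (Order.lt_succ_iff_of_not_isMax hj).1 hy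
      obtain ⟨y, hy, hym, hmax, hWy⟩ | ⟨-, hcol⟩ :=
        h.step (Order.succ j).1 (Order.succ j).2
          (fun e => (lt_of_le_of_lt bot_le hlt).ne (Subtype.ext e.symm))
      · obtain rfl : y = j := le_antisymm (hle (y := ⟨y, hy⟩) hym) (hmax j j.2 hlt)
        exact hWy
      -- A limit step cannot occur at the successor of `j`: everything below is contained in `j`,
      -- hence so would be the colimit.
      · exfalso
        obtain ⟨l, hl⟩ := hcol.exists_desc (Z := (j.1 : C))
          (fun y hy => underlying.map (homOfLE (hle (y := ⟨y, hy.1⟩) hy.2)))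
          (fun _ _ _ => by rw [← Functor.map_comp]; rfl)
        refine hlt.not_ge (le_of_comm l (hcol.hom_ext fun y hy => ?_))
        rw [← Category.assoc, hl y hy]
        simp only [underlying_map_arrow]
  rw [MorphismProperty.transfiniteCompositionsOfShape_eq_of_orderIso W
    (orderIsoShrink.{v} Φ)] at key
  exact MorphismProperty.transfiniteCompositionsOfShape_le_transfiniteCompositions _ _ _ key

lemma IsColimitOn.of_cofinal {s s' : Set (Subobject N)} {x : Subobject N} {hs : ∀ y ∈ s, y ≤ x}
    (hs' : ∀ y ∈ s', y ≤ x)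
    (h : IsColimitOn underlying s (fun y hy => underlying.map (homOfLE (hs y hy))))
    (hss' : s ⊆ s') (hcof : ∀ y ∈ s', ∃ z ∈ s, y ≤ z) :
    IsColimitOn underlying s' (fun y hy => underlying.map (homOfLE (hs' y hy))) where
  w _ _ _ := by rw [← Functor.map_comp]; rfl
  hom_ext H := h.hom_ext fun j hj => H j (hss' hj)
  exists_desc τ hτ := by
    obtain ⟨l, hl⟩ := h.exists_desc (fun y hy => τ y (hss' hy))
      (fun hi hj hij => hτ (hss' hi) (hss' hj) hij)
    refine ⟨l, fun y hy => ?_⟩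
    obtain ⟨z, hz, hyz⟩ := hcof y hy
    rw [← hτ hy (hss' hz) hyz, ← hl z hz, ← Category.assoc, ← Functor.map_comp]
    rfl

/-- Towers can be refined. -/
lemma IsTower.refine {W' : MorphismProperty C} {Φ : Set (Subobject N)} {a b : Subobject N}
    (h : IsTower W' Φ a b)
    (hW : ∀ {x y : Subobject N} (hxy : x ≤ y), W' (underlying.map (homOfLE hxy)) →
      ∃ Ψ, IsTower W Ψ x y) : ∃ Φ', IsTower W Φ' a b := by
  -- The block `Ψ x` is a tower from the predecessor of `x` to `x`, or just `{x}` when `x` is `a` or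
  -- a limit. The union of the blocks is ordered lexicographically, as `Ψ x` lies above all earlier
  -- elements of `Φ`. The first alternative for `z` is the left end of a block, which already
  -- belongs to an earlier one.
  have (x : Subobject N) (hx : x ∈ Φ) : ∃ Ψ : Set (Subobject N), Small.{v} Ψ ∧ x ∈ Ψ ∧
      (∀ z ∈ Ψ, z ≤ x) ∧ (∀ y ∈ Φ, y < x → ∀ z ∈ Ψ, y ≤ z) ∧ (∀ z ∈ Ψ, a ≤ z) ∧
      (∀ s ⊆ Ψ, s.Nonempty → ∃ x ∈ s, ∀ y ∈ s, x ≤ y) ∧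
      (∀ z ∈ Ψ, (z ∈ Φ ∧ z < x) ∨ z = a ∨ IsTowerStep W Ψ z ∨
        (Ψ = {x} ∧ (∃ y ∈ Φ, y < x) ∧ IsColimitOn underlying {y | y ∈ Φ ∧ y < x}
          (fun _ hy => underlying.map (homOfLE hy.2.le)))) := by
    have hsingle : ∀ s ⊆ ({x} : Set (Subobject N)), s.Nonempty → ∃ x ∈ s, ∀ y ∈ s, x ≤ y := by
      rintro s hs ⟨y, hy⟩
      obtain rfl : y = x := hs hy
      exact ⟨y, hy, fun z hz => (hs hz).ge⟩
    by_cases hxa : x = a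
    · subst hxa
      exact ⟨{x}, inferInstance, rfl, fun z hz => hz.le, fun y hy hyx => (hyx.not_ge
        (h.left_le y hy)).elim, fun z hz => hz.ge, hsingle, fun z hz => Or.inr (Or.inl hz)⟩
    obtain ⟨y, hy, hyx, hmax, hyW⟩ | ⟨hne, hcol⟩ := h.step x hx hxa
    · obtain ⟨Ψ, hΨ⟩ := hW hyx.le hyW
      refine ⟨Ψ, hΨ.small, hΨ.right_mem, hΨ.le_right, fun y' hy' hyx' z hz =>
        (hmax y' hy' hyx').trans (hΨ.left_le z hz), fun z hz => (h.left_le y hy).trans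
        (hΨ.left_le z hz), hΨ.exists_least, fun z hz => ?_⟩
      by_cases hzy : z = y
      · exact Or.inl ⟨hzy ▸ hy, hzy ▸ hyx⟩
      · exact Or.inr (Or.inr (Or.inl (hΨ.step z hz hzy)))
    · refine ⟨{x}, inferInstance, rfl, fun z hz => hz.le, ?_, ?_, hsingle, ?_⟩
      · rintro y hy hyx z rfl
        exact hyx.le
      · rintro z rfl
        exact h.left_le z hx
      · rintro z rfl
        exact Or.inr (Or.inr (Or.inr ⟨rfl, hne, hcol⟩))
  choose! Ψ hsmall hmem hle hge hage hleast hstep using this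
  have hsm := h.small
  have hsm' (x : Φ) : Small.{v} (Ψ x) := hsmall x x.2
  have hU : ⋃ x : Φ, Ψ x = {z | ∃ x ∈ Φ, z ∈ Ψ x} := by
    ext z
    simp
  refine ⟨{z | ∃ x ∈ Φ, z ∈ Ψ x}, ⟨hU ▸ inferInstance, ⟨a, h.left_mem, hmem a h.left_mem⟩,
    ⟨b, h.right_mem, hmem b h.right_mem⟩, ?_, ?_, ?_, ?_⟩⟩
  · rintro z ⟨x, hx, hz⟩
    exact hage x hx z hz
  · rintro z ⟨x, hx, hz⟩
    exact (hle x hx z hz).trans (h.le_right x hx)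
  · rintro s hs ⟨z, hz⟩
    obtain ⟨x₀, hx₀, hzx₀⟩ := hs hz
    obtain ⟨x, ⟨hx, z', hz', hzx'⟩, hxmin⟩ := h.exists_least {x | x ∈ Φ ∧ ∃ z ∈ s, z ∈ Ψ x}
      (fun x hx => hx.1) ⟨x₀, hx₀, z, hz, hzx₀⟩
    obtain ⟨w, ⟨hw, hwx⟩, hwmin⟩ := hleast x hx {z | z ∈ s ∧ z ∈ Ψ x} (fun z hz => hz.2)
      ⟨z', hz', hzx'⟩
    refine ⟨w, hw, fun y hy => ?_⟩
    obtain ⟨x', hx', hyx'⟩ := hs hy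
    obtain rfl | hlt := (hxmin x' ⟨hx', y, hy, hyx'⟩).eq_or_lt
    · exact hwmin y ⟨hy, hyx'⟩
    · exact (hle x hx w hwx).trans (hge x' hx' x hx hlt y hyx')
  · rintro z ⟨x₀, hx₀, hzx₀⟩ hza
    -- Take the first block containing `z`. Whatever lies below `z` is in this block or is dominated
    -- by an earlier element of `Φ`, so the step at `z` is decided inside the block, or in `Φ`
    -- itself when `x` is a limit there.
    obtain ⟨x, ⟨hx, hzx⟩, hxmin⟩ := h.exists_least {x | x ∈ Φ ∧ z ∈ Ψ x}
      (fun x hx => hx.1) ⟨x₀, hx₀, hzx₀⟩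
    have hbelow {w : Subobject N} (hwz : w < z) (hw : ∃ x ∈ Φ, w ∈ Ψ x) :
        w ∈ Ψ x ∨ ∃ y ∈ Φ, y < x ∧ w ≤ y := by
      obtain ⟨x', hx', hwx'⟩ := hw
      obtain hlt | rfl | hlt : x' < x ∨ x' = x ∨ x < x' := by
        rcases h.total hx hx' with hxx | hxx
        · exact hxx.eq_or_lt.elim (fun e => Or.inr (Or.inl e.symm)) fun e => Or.inr (Or.inr e)
        · exact hxx.eq_or_lt.elim (fun e => Or.inr (Or.inl e)) Or.inl
      · exact Or.inr ⟨x', hx', hlt, hle x' hx' w hwx'⟩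
      · exact Or.inl hwx'
      · exact (hwz.not_ge ((hle x hx z hzx).trans (hge x' hx' x hx hlt w hwx'))).elim
    obtain ⟨hzΦ, hzlt⟩ | hz | (⟨y, hy, hyz, hmax, hyW⟩ | ⟨⟨y, hy, hyz⟩, hcol⟩) |
      ⟨hΨ, ⟨y, hy, hyx⟩, hcol⟩ := hstep x hx z hzx
    · exact (hzlt.not_ge (hxmin z ⟨hzΦ, hmem z hzΦ⟩)).elim
    · exact (hza hz).elim
    · refine Or.inl ⟨y, ⟨x, hx, hy⟩, hyz, fun w hw hwz => ?_, hyW⟩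
      obtain hw | ⟨x', hx', hlt, hw⟩ := hbelow hwz hw
      · exact hmax w hw hwz
      · exact hw.trans (hge x hx x' hx' hlt y hy)
    · refine Or.inr ⟨⟨y, ⟨x, hx, hy⟩, hyz⟩, hcol.of_cofinal _ (fun w hw => ⟨⟨x, hx, hw.1⟩, hw.2⟩)
        fun w hw => ?_⟩
      obtain hw' | ⟨x', hx', hlt, hw'⟩ := hbelow hw.2 hw.1
      · exact ⟨w, ⟨hw', hw.2⟩, le_rfl⟩
      · exact ⟨y, ⟨hy, hyz⟩, hw'.trans (hge x hx x' hx' hlt y hy)⟩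
    · obtain rfl : z = x := by rw [hΨ] at hzx; exact hzx
      refine Or.inr ⟨⟨y, ⟨y, hy, hmem y hy⟩, hyx⟩, hcol.of_cofinal _
        (fun w hw => ⟨⟨w, hw.1, hmem w hw.1⟩, hw.2⟩) fun w hw => ?_⟩
      obtain hw' | ⟨x', hx', hlt, hw'⟩ := hbelow hw.2 hw.1
      · rw [hΨ] at hw'
        exact (hw.2.ne hw').elim
      · exact ⟨x', ⟨hx', hlt⟩, hw'⟩

end Towers

/-- Transfinite compositions of transfinite compositions are transfinite compositions. -/
lemma ExactStructure.HasTransfiniteCompositions.transfiniteCompositions_transfiniteCompositions_le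
    {C : Type u} [Category.{v} C] [Preadditive C] {E : ExactStructure C}
    (hcomp : E.HasTransfiniteCompositions) {W : MorphismProperty C} (hW : W ≤ E.inflations)
    [W.RespectsIso] :
    MorphismProperty.transfiniteCompositions.{v} (MorphismProperty.transfiniteCompositions.{v} W) ≤
      MorphismProperty.transfiniteCompositions.{v} W := by
  intro M N f hf
  have hW' := hcomp.transfiniteCompositions_le hW
  have : Mono f := inflations_mono (hcomp.transfiniteCompositions_le hW' f hf)
  -- Being a monomorphism, `f` can be treated as the inclusion of a subobject of `N` into `⊤`, where
  -- towers apply.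
  have e : Arrow.mk (Subobject.underlying.map (homOfLE (le_top : Subobject.mk f ≤ ⊤))) ≅
      Arrow.mk f := Arrow.isoMk (Subobject.underlyingIso f) (asIso (⊤ : Subobject N).arrow)
        (by simp)
  rw [← MorphismProperty.arrow_mk_iso_iff (MorphismProperty.transfiniteCompositions _) e] at hf ⊢
  obtain ⟨Φ, hΦ⟩ := hcomp.exists_isTower hW' _ hf
  obtain ⟨Φ', hΦ'⟩ := hΦ.refine fun h => hcomp.exists_isTower hW h
  exact hΦ'.transfiniteCompositions _

/-! ### Transfinite iterations in categories with few colimits -/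

section Iteration

variable {B : Type*} [Category* B]

lemma CategoryTheory.Functor.nonempty_arrow_iso {D : Type*} [Category* D] (Y : B ⥤ D) [Y.Full]
    [Y.Faithful] {X X' Z Z' : B} {f : X ⟶ X'} {g : Z ⟶ Z'}
    (e : Arrow.mk (Y.map f) ≅ Arrow.mk (Y.map g)) : Nonempty (Arrow.mk f ≅ Arrow.mk g) := by
  let l : Y.obj X ≅ Y.obj Z := Arrow.leftFunc.mapIso e
  let r : Y.obj X' ≅ Y.obj Z' := Arrow.rightFunc.mapIso e
  have h : l.hom ≫ Y.map g = Y.map f ≫ r.hom := Arrow.w e.hom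
  exact ⟨Arrow.isoMk (Y.preimageIso l) (Y.preimageIso r) (Y.map_injective (by simpa using h))⟩

/-- Transfinite iteration of a construction `X ⟶ s X` in a full subcategory, closed under the
relevant colimits, of a category with all colimits. -/
lemma exists_iteration_of_fullyFaithful {D : Type*} [Category* D] (Y : B ⥤ D) [Y.Full]
    [Y.Faithful] [HasColimitsOfSize.{v, v} D] [PreservesColimitsOfSize.{v, v} Y]
    (Q : MorphismProperty B) [Q.RespectsIso]
    (hQ : ∀ (J : Type v) [LinearOrder J] [SuccOrder J] [OrderBot J] [WellFoundedLT J]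
      (F : J ⥤ B) [F.IsWellOrderContinuous],
      (∀ j, ¬ IsMax j → Q (F.map (homOfLE (Order.le_succ j)))) → HasColimit F)
    (s : B → B) (toS : ∀ X, X ⟶ s X) (hs : ∀ X, Q (toS X)) (X₀ : B)
    (J : Type v) [LinearOrder J] [SuccOrder J] [OrderBot J] [WellFoundedLT J] :
    ∃ F : J ⥤ B, F.IsWellOrderContinuous ∧ Nonempty (F.obj ⊥ ≅ X₀) ∧
      ∀ j, ¬ IsMax j →
        ∃ X, Nonempty (Arrow.mk (F.map (homOfLE (Order.le_succ j))) ≅ Arrow.mk (toS X)) := by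
  classical
  -- The iteration in `D` needs a construction on all objects: outside the essential image of `Y`
  -- the identity serves as a default.
  have hS (Z : D) : ∃ (Z' : D) (f : Z ⟶ Z'), Y.essImage Z →
      ∃ X, Nonempty (Arrow.mk f ≅ Arrow.mk (Y.map (toS X))) := by
    by_cases h : Y.essImage Z
    · obtain ⟨X, ⟨e⟩⟩ := h
      exact ⟨Y.obj (s X), e.inv ≫ Y.map (toS X), fun _ =>
        ⟨X, ⟨Arrow.isoMk e.symm (Iso.refl _) (by simp)⟩⟩⟩
    · exact ⟨Z, 𝟙 Z, fun h' => (h h').elim⟩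
  choose S toSucc hS using hS
  let Φ : SmallObject.SuccStruct D := ⟨Y.obj X₀, S, toSucc⟩
  let G := Φ.iterationFunctor J
  have hsucc (j : J) (hj : ¬ IsMax j) (h : Y.essImage (G.obj j)) :
      ∃ X, Nonempty (Arrow.mk (G.map (homOfLE (Order.le_succ j))) ≅
        Arrow.mk (Y.map (toS X))) := by
    obtain ⟨X, ⟨e⟩⟩ := hS _ h
    refine ⟨X, ⟨?_ ≪≫ e⟩⟩
    exact Arrow.isoMk (Iso.refl _) (Φ.iterationFunctorObjSuccIso j hj)
      (by simp [G, Φ.iterationFunctor_map_succ j hj, Φ])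
  -- Formulated for a monotone map `α` so as to cover both the initial segments `Set.Iio m` and `J`
  -- itself.
  have hstep {J' : Type v} [LinearOrder J'] [SuccOrder J'] [OrderBot J'] (α : J' → J)
      (hα : Monotone α) (F : J' ⥤ B) (e : F ⋙ Y ≅ hα.functor ⋙ G) (j : J')
      (hj : ¬ IsMax (α j)) (hj' : α (Order.succ j) = Order.succ (α j)) :
      ∃ X, Nonempty (Arrow.mk (F.map (homOfLE (Order.le_succ j))) ≅ Arrow.mk (toS X)) := by
    obtain ⟨X, ⟨e'⟩⟩ := hsucc (α j) hj ⟨F.obj j, ⟨e.app j⟩⟩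
    have e₁ : Arrow.mk (Y.map (F.map (homOfLE (Order.le_succ j)))) ≅
        Arrow.mk (G.map (homOfLE (hα (Order.le_succ j)))) :=
      Arrow.isoMk (e.app j) (e.app (Order.succ j)) (e.hom.naturality _).symm
    have e₂ : Arrow.mk (G.map (homOfLE (hα (Order.le_succ j)))) =
        Arrow.mk (G.map (homOfLE (Order.le_succ (α j)))) :=
      congrArg G.mapArrow.obj (Arrow.ext rfl hj' rfl :
        Arrow.mk (homOfLE (hα (Order.le_succ j))) = Arrow.mk (homOfLE (Order.le_succ (α j))))
    let e₃ := e₁ ≪≫ eqToIso e₂ ≪≫ e'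
    exact ⟨X, Y.nonempty_arrow_iso e₃⟩
  have hcont {J' : Type v} [PartialOrder J'] (F : J' ⥤ B) (G' : J' ⥤ D)
      [hG' : G'.IsWellOrderContinuous] (e : F ⋙ Y ≅ G') : F.IsWellOrderContinuous := by
    have := Functor.isWellOrderContinuous_of_iso e.symm
    exact ⟨fun m hm => ⟨isColimitOfReflects Y
      (by exact (F ⋙ Y).isColimitOfIsWellOrderContinuous m hm)⟩⟩
  have key (j : J) : Y.essImage (G.obj j) := by
    induction j using SuccOrder.limitRecOn with
    | isMin j hj =>
      obtain rfl := hj.eq_bot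
      exact ⟨X₀, ⟨(Φ.iterationFunctorObjBotIso J).symm⟩⟩
    | succ j hj ih =>
      obtain ⟨X, ⟨e⟩⟩ := hsucc j hj ih
      exact ⟨s X, ⟨(Arrow.rightFunc.mapIso e).symm⟩⟩
    | isSuccLimit m hm ih =>
      let : OrderBot (Set.Iio m) := { bot := ⟨⊥, hm.bot_lt⟩, bot_le := fun q => bot_le (a := q.1) }
      let α : Set.Iio m → J := (↑)
      have hα : Monotone α := (Set.principalSegIio m).monotone
      -- The part below `m` lifts to `B`, where `hQ` supplies a colimit; `Y` preserves it, so stage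
      -- `m` is again in the essential image.
      let F := Functor.essImage.liftFunctor (hα.functor ⋙ G) Y (fun q => ih q.1 q.2)
      let e : F ⋙ Y ≅ hα.functor ⋙ G := Functor.essImage.liftFunctorCompIso _ _ _
      have : (hα.functor ⋙ G).IsWellOrderContinuous :=
        inferInstanceAs (((Set.principalSegIio m : Set.Iio m ≤i J).monotone.functor ⋙
          G).IsWellOrderContinuous)
      have := hcont F _ e
      have := hQ (Set.Iio m) F fun q hq => by
        obtain ⟨X, ⟨e'⟩⟩ := hstep α hα F e q (not_isMax_iff.2 ⟨m, q.2⟩)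
          (coe_succ_of_mem (Set.mem_Iio.2 (hm.succ_lt q.2)))
        exact (MorphismProperty.arrow_mk_iso_iff Q e').2 (hs X)
      have hc := isColimitOfPreserves Y (colimit.isColimit F)
      exact ⟨colimit F, ⟨hc.coconePointsIsoOfNatIso (G.isColimitOfIsWellOrderContinuous m hm) e⟩⟩
  let F := Functor.essImage.liftFunctor G Y key
  let e : F ⋙ Y ≅ G := Functor.essImage.liftFunctorCompIso _ _ _
  refine ⟨F, hcont F G e, ⟨Y.preimageIso (e.app ⊥ ≪≫ Φ.iterationFunctorObjBotIso J)⟩,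
    fun j hj => ?_⟩
  exact hstep id monotone_id F e j hj rfl

/-- The ambient category is the opposite of the category of functors `B ⥤ Type v`: it has all small
colimits, and the co-Yoneda embedding into it is fully faithful and preserves those existing in `B`.
-/
lemma exists_iteration {B : Type u} [Category.{v} B] (Q : MorphismProperty B) [Q.RespectsIso]
    (hQ : ∀ (J : Type v) [LinearOrder J] [SuccOrder J] [OrderBot J] [WellFoundedLT J]
      (F : J ⥤ B) [F.IsWellOrderContinuous],
      (∀ j, ¬ IsMax j → Q (F.map (homOfLE (Order.le_succ j)))) → HasColimit F)
    (s : B → B) (toS : ∀ X, X ⟶ s X) (hs : ∀ X, Q (toS X)) (X₀ : B)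
    (J : Type v) [LinearOrder J] [SuccOrder J] [OrderBot J] [WellFoundedLT J] :
    ∃ F : J ⥤ B, F.IsWellOrderContinuous ∧ Nonempty (F.obj ⊥ ≅ X₀) ∧
      ∀ j, ¬ IsMax j →
        ∃ X, Nonempty (Arrow.mk (F.map (homOfLE (Order.le_succ j))) ≅ Arrow.mk (toS X)) := by
  have : PreservesColimitsOfSize.{v, v} (coyoneda (C := B)).rightOp :=
    preservesColimitsOfSize_rightOp _
  exact exists_iteration_of_fullyFaithful (coyoneda (C := B)).rightOp Q hQ s toS hs X₀ J

end Iteration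

/-! ### The small object argument -/

/-- The objects of a small family are `κ`-small relative to `W` for a common regular cardinal. -/
lemma exists_isRegular_forall_isCardinalSmallRelativeTo {C : Type u} [Category.{v} C]
    {W : MorphismProperty C}
    (hsmall : ∀ X : C, IsSmallRelativeTo X W) {T : Type v} (A : T → C) :
    ∃ κ : Cardinal.{v}, κ.IsRegular ∧ ∀ t, IsCardinalSmallRelativeTo (A t) W κ := by
  choose κ _ hκ using fun t => hsmall (A t)
  -- A successor of an infinite cardinal is regular, and smallness persists for larger cardinals
  -- because fewer sequences have to be tested.
  refine ⟨Order.succ (max Cardinal.aleph0 (⨆ t, κ t)),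
    Cardinal.isRegular_succ (le_max_left _ _), fun t J _ _ _ _ hJ => hκ t J (le_trans ?_ hJ)⟩
  exact (le_ciSup Cardinal.bddAbove_of_small t).trans
    ((le_max_right _ _).trans (Order.le_succ _))

namespace ExactStructure

variable {C : Type u} [Category.{v} C] [Preadditive C] {E : ExactStructure C}

lemma IsSetOfInflations.pushouts_le {I : MorphismProperty C} (hI : E.IsSetOfInflations I) :
    I.pushouts ≤ E.inflations :=
  (MorphismProperty.pushouts_le_iff (P := I) (Q := E.inflations)).2 hI.2

/-- All lifting problems from maps in `I` to `g` are solved after attaching cells. -/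
lemma HasTransfiniteCompositions.exists_step (hcomp : E.HasTransfiniteCompositions)
    {I : MorphismProperty C} (hI : E.IsSetOfInflations I) {X N : C} (g : X ⟶ N) :
    ∃ (X' : C) (j : X ⟶ X') (g' : X' ⟶ N), j ≫ g' = g ∧
      MorphismProperty.transfiniteCompositions.{v} I.pushouts j ∧
      ∀ {A B : C} (i : A ⟶ B), I i → ∀ (p : A ⟶ X) (q : B ⟶ N), p ≫ g = i ≫ q →
        ∃ l : B ⟶ X', i ≫ l = p ≫ j ∧ l ≫ g' = q := by
  have := hI.1.small_toSet
  let T := Shrink.{v} I.toSet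
  let a (t : T) : Arrow C := ((equivShrink I.toSet).symm t).1
  have ha (t : T) : I (a t).hom := ((equivShrink I.toSet).symm t).2
  -- One cell for each commutative square from a map of `I` to `g`; these form a set because `I` is
  -- small.
  let K := Σ t : T, { pq : ((a t).left ⟶ X) × ((a t).right ⟶ N) //
    pq.1 ≫ g = (a t).hom ≫ pq.2 }
  obtain ⟨c, hc⟩ := hcomp.exists_cellAttachment hI.pushouts_le (fun k : K => (a k.1).hom)
    (fun k => k.2.1.1) (fun k => I.le_pushouts _ (ha k.1))
  obtain ⟨g', h₁, h₂⟩ := c.exists_desc g (fun k _ => k.2.1.2) (fun k _ => k.2.2)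
  refine ⟨c.pt, c.base, g', h₁, hc, fun {A B} i hi p q w => ?_⟩
  obtain ⟨t, ht⟩ : ∃ t : T, a t = Arrow.mk i := ⟨equivShrink I.toSet ⟨Arrow.mk i, hi⟩, by simp [a]⟩
  have key (b : Arrow C) (hb : a t = b) (p : b.left ⟶ X) (q : b.right ⟶ N)
      (w : p ≫ g = b.hom ≫ q) :
      ∃ l : b.right ⟶ c.pt, b.hom ≫ l = p ≫ c.base ∧ l ≫ g' = q := by
    subst hb
    exact ⟨c.cell ⟨t, ⟨(p, q), w⟩⟩ trivial, (c.w ⟨t, ⟨(p, q), w⟩⟩ trivial).symm,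
      h₂ ⟨t, ⟨(p, q), w⟩⟩ trivial⟩
  exact key _ ht p q w


/-- The small object argument. -/
lemma HasTransfiniteCompositions.exists_factorization [HasBinaryBiproducts C]
    (hcomp : E.HasTransfiniteCompositions)
    (hsmall : ∀ X : C, IsSmallRelativeTo X E.inflations)
    {I : MorphismProperty C} (hI : E.IsSetOfInflations I) {M N : C} (f : M ⟶ N) :
    ∃ (Z : C) (i : M ⟶ Z) (p : Z ⟶ N), i ≫ p = f ∧
      MorphismProperty.transfiniteCompositions.{v} I.pushouts i ∧ I.rlp p := by
  have hW := hI.pushouts_le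
  have hW' := hcomp.transfiniteCompositions_le hW
  have := hI.1.small_toSet
  obtain ⟨κ, hκ, hκI⟩ := exists_isRegular_forall_isCardinalSmallRelativeTo hsmall
    (fun t : Shrink.{v} I.toSet => ((equivShrink I.toSet).symm t).1.left)
  replace hκI {A B : C} (i : A ⟶ B) (hi : I i) : IsCardinalSmallRelativeTo A E.inflations κ := by
    simpa using hκI (equivShrink I.toSet ⟨Arrow.mk i, hi⟩)
  -- The initial ordinal of `κ` is used: by regularity its cofinality is `κ`, and it has no maximum.
  obtain ⟨J, _, _, _, _, _, hcof⟩ : ∃ (J : Type v) (_ : LinearOrder J) (_ : SuccOrder J)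
      (_ : OrderBot J) (_ : WellFoundedLT J) (_ : NoMaxOrder J), κ ≤ Order.cof J := by
    have : Nonempty κ.ord.ToType := by
      rw [Ordinal.nonempty_toType_iff]
      exact fun h => hκ.pos.ne' (by simpa using h)
    exact ⟨κ.ord.ToType, inferInstance, inferInstance, WellFoundedLT.toOrderBot _, inferInstance,
      Cardinal.noMaxOrder hκ.aleph0_le, by rw [Ordinal.cof_toType, hκ.cof_ord]⟩
  -- Iterating over `N` carries the maps to `N` along. Binary products make the forgetful functor a
  -- left adjoint, so its colimits are those of the underlying objects.
  have : PreservesColimitsOfSize.{v, v} (Over.forget N) :=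
    (Over.forgetAdjStar N).leftAdjoint_preservesColimits
  have hforget (J : Type v) [LinearOrder J] :
      PreservesWellOrderContinuousOfShape J (Over.forget N) := ⟨fun _ _ => inferInstance⟩
  choose s toS toN hN htoS hlift using
    fun X : Over N => hcomp.exists_step hI X.hom
  obtain ⟨F, hF, ⟨e⟩, hsucc⟩ := exists_iteration
    (E.inflations.inverseImage (Over.forget N)) (fun J _ _ _ _ F _ hF => by
      obtain ⟨c, ⟨hc⟩, -⟩ := hcomp J (F ⋙ Over.forget N) hF
      have : HasColimit (F ⋙ Over.forget N) := ⟨⟨c, hc⟩⟩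
      exact hasColimit_of_created F (Over.forget N))
    (fun X => Over.mk (toN X)) (fun X => Over.homMk (toS X) (hN X))
    (fun X => hW' _ (htoS X)) (Over.mk f) J
  have htc (j : J) : MorphismProperty.transfiniteCompositions.{v} I.pushouts
      (F.map (homOfLE (Order.le_succ j))).left := by
    obtain ⟨X, ⟨e⟩⟩ := hsucc j (not_isMax j)
    exact ((MorphismProperty.transfiniteCompositions.{v} I.pushouts).arrow_mk_iso_iff
      ((Over.forget N).mapArrow.mapIso e)).2 (htoS X)
  have hlift' (j : J) {A B : C} (i : A ⟶ B) (hi : I i) (p : A ⟶ (F.obj j).left) (q : B ⟶ N)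
      (w : p ≫ (F.obj j).hom = i ≫ q) : ∃ l : B ⟶ (F.obj (Order.succ j)).left,
        i ≫ l = p ≫ (F.map (homOfLE (Order.le_succ j))).left ∧
          l ≫ (F.obj (Order.succ j)).hom = q := by
    obtain ⟨X, ⟨e⟩⟩ := hsucc j (not_isMax j)
    have h₁ : e.hom.left.left ≫ X.hom = (F.obj j).hom := Over.w e.hom.left
    have h₂ : e.inv.right.left ≫ (F.obj (Order.succ j)).hom = toN X := Over.w e.inv.right
    have h₃ : toS X ≫ e.inv.right.left =
        e.inv.left.left ≫ (F.map (homOfLE (Order.le_succ j))).left :=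
      congr_arg CommaMorphism.left e.inv.w.symm
    have h₄ : e.hom.left.left ≫ e.inv.left.left = 𝟙 _ :=
      congr_arg (fun φ => CommaMorphism.left (CommaMorphism.left φ)) e.hom_inv_id
    obtain ⟨l, hl, hl'⟩ := hlift X i hi (p ≫ e.hom.left.left) q (by rw [Category.assoc, h₁, w])
    exact ⟨l ≫ e.inv.right.left, by rw [reassoc_of% hl, h₃, reassoc_of% h₄],
      by rw [Category.assoc, h₂, hl']⟩
  obtain ⟨c, ⟨hc⟩, -⟩ := hcomp J (F ⋙ Over.forget N) fun j _ => hW' _ (htc j)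
  have : HasColimit (F ⋙ Over.forget N) := ⟨⟨c, hc⟩⟩
  have : HasColimit F := hasColimit_of_created F (Over.forget N)
  have hc' : IsColimit ((Over.forget N).mapCocone (colimit.cocone F)) :=
    isColimitOfPreserves (Over.forget N) (colimit.isColimit F)
  refine ⟨(colimit F).left, (e.inv ≫ colimit.ι F ⊥).left, (colimit F).hom, Over.w _, ?_, ?_⟩
  -- Each step of the iteration is itself a transfinite composition of pushouts of maps in `I`,
  -- hence the flattening.
  · refine hcomp.transfiniteCompositions_transfiniteCompositions_le hW _ ?_
    refine MorphismProperty.transfiniteCompositionsOfShape_le_transfiniteCompositions _ J _ ⟨?_⟩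
    exact
      { F := F ⋙ Over.forget N
        isoBot := (Over.forget N).mapIso e
        incl := ((Over.forget N).mapCocone (colimit.cocone F)).ι
        isColimit := hc'
        map_mem := fun j _ => htc j }
  · intro A B i hi
    refine ⟨fun {p q} sq => ⟨?_⟩⟩
    have := hκI i hi J hcof (F ⋙ Over.forget N) fun j _ => hW' _ (htc j)
    -- By smallness the top map of the square factors through a stage `j`, and the resulting square
    -- was solved at the next stage.
    obtain ⟨j, a, ha⟩ : ∃ (j : J) (a : A ⟶ (F.obj j).left), a ≫ (colimit.ι F j).left = p :=
      Types.jointly_surjective_of_isColimit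
        (isColimitOfPreserves (coyoneda.obj (Opposite.op A)) hc') p
    have hw (j : J) : (colimit.ι F j).left ≫ (colimit F).hom = (F.obj j).hom := Over.w _
    obtain ⟨l, hl, hl'⟩ := hlift' j i hi a q (by rw [← hw, reassoc_of% ha, sq.w])
    have hs : (F.map (homOfLE (Order.le_succ j))).left ≫ (colimit.ι F (Order.succ j)).left =
        (colimit.ι F j).left := congr_arg CommaMorphism.left (colimit.w F _)
    exact ⟨⟨l ≫ (colimit.ι F (Order.succ j)).left, by rw [reassoc_of% hl, hs, ha],
      by rw [Category.assoc, hw, hl']⟩⟩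

end ExactStructure

/-! ### Cell complexes and filtered objects -/

namespace ExactStructure

open ZeroObject

variable {C : Type u} [Category.{v} C] [Preadditive C] {E : ExactStructure C}

lemma HasTransfiniteCompositions.isStableUnderTransfiniteComposition_transfiniteCompositions
    (hcomp : E.HasTransfiniteCompositions) {W : MorphismProperty C} (hW : W ≤ E.inflations)
    [W.RespectsIso] : MorphismProperty.IsStableUnderTransfiniteComposition.{v}
      (MorphismProperty.transfiniteCompositions.{v} W) where
  isStableUnderTransfiniteCompositionOfShape J _ _ _ _ :=
    ⟨(MorphismProperty.transfiniteCompositionsOfShape_le_transfiniteCompositions _ J).trans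
      (hcomp.transfiniteCompositions_transfiniteCompositions_le hW)⟩

section

variable [HasBinaryBiproducts C]

lemma le_leftPerp_rightPerp (S : ObjectProperty C) : S ≤ E.leftPerp (E.rightPerp S) :=
  fun X hX _ hY => hY X hX

lemma rightPerp_leftPerp_rightPerp (S : ObjectProperty C) :
    E.rightPerp (E.leftPerp (E.rightPerp S)) = E.rightPerp S :=
  le_antisymm (rightPerp_antitone (le_leftPerp_rightPerp S)) fun Y hY _ hX => hX Y hY

end

variable [HasZeroObject C]

/-- Seeing a cokernel as a cobase change along `A ⟶ 0` turns statements about maps into statements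
about `0 ⟶ X`. -/
lemma IsConflation.isPushout_zero {A B X : C} {f : A ⟶ B} {g : B ⟶ X}
    (h : E.IsConflation f g) : IsPushout (0 : A ⟶ (0 : C)) f 0 g := by
  have := h.epi
  refine IsPushout.flip ⟨⟨by simp [h.zero]⟩, ⟨?_⟩⟩
  have (s : PushoutCocone f (0 : A ⟶ (0 : C))) : ∃ l : X ⟶ s.pt, g ≫ l = s.inl :=
    h.exists_desc _ (by rw [s.condition, zero_comp])
  choose l hl using this
  exact PushoutCocone.IsColimit.mk _ l hl (fun s => (isZero_zero C).eq_of_src _ _)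
    (fun s m hm _ => by rw [← cancel_epi g, hm, hl])

/-- The cokernel of a transfinite composition of maps in `W` is built from maps in `W`. -/
lemma IsConflation.transfiniteCompositions_zero (hcomp : E.HasTransfiniteCompositions)
    {W : MorphismProperty C} (hW : W ≤ E.inflations) [W.IsStableUnderCobaseChange]
    {A B X : C} {f : A ⟶ B} {g : B ⟶ X} (h : E.IsConflation f g)
    (hf : MorphismProperty.transfiniteCompositions.{v} W f) :
    MorphismProperty.transfiniteCompositions.{v} W (0 : (0 : C) ⟶ X) :=
  (hcomp.isStableUnderCobaseChange hW).of_isPushout h.isPushout_zero hf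

lemma cokers_le_cellObjects (I : MorphismProperty C) : E.cokers I ≤ cellObjects I := by
  rintro S ⟨A, B, i, p, hi, h⟩
  exact MorphismProperty.le_transfiniteCompositions _ _
    (MorphismProperty.pushouts_mk _ h.isPushout_zero hi)

lemma cellObjects_le_filt {I : MorphismProperty C} (hI : I ≤ E.inflations) :
    cellObjects I ≤ E.filt (E.cokers I) := fun _ hX =>
  MorphismProperty.transfiniteCompositions_monotone (pushouts_le_inflationsWithCokerIn hI) _ hX

lemma IsStronglyHomological.cellObjects_eq_filt {I : MorphismProperty C} (hI : I ≤ E.inflations)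
    (h : E.IsStronglyHomological I) : cellObjects I = E.filt (E.cokers I) :=
  le_antisymm (cellObjects_le_filt hI) fun _ hX =>
    MorphismProperty.transfiniteCompositions_monotone h.inflationsWithCokerIn_le _ hX

/-- A coproduct of `S`-filtered objects is `S`-filtered. -/
lemma filt_cofan (hcomp : E.HasTransfiniteCompositions) {S : ObjectProperty C} {K : Type v}
    {A : K → C} {c : Cofan A} (hc : IsColimit c) (hA : ∀ k, E.filt S (A k)) :
    E.filt S c.pt := by
  have hW := E.inflationsWithCokerIn_le S
  have := hcomp.isStableUnderCobaseChange hW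
  -- A coproduct is the result of attaching the cells `0 ⟶ A k` to `0`; each cell is a transfinite
  -- composition, so flattening is needed once more.
  obtain ⟨a, ha⟩ := hcomp.exists_cellAttachment (hcomp.transfiniteCompositions_le hW)
    (fun k => (0 : (0 : C) ⟶ A k)) (fun _ => 𝟙 0) hA
  replace ha := hcomp.transfiniteCompositions_transfiniteCompositions_le hW _ ha
  let φ : c.pt ⟶ a.pt := Cofan.IsColimit.desc hc fun k => a.cell k (Set.mem_univ k)
  have hφ (k : K) : c.inj k ≫ φ = a.cell k (Set.mem_univ k) := Cofan.IsColimit.fac hc _ k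
  obtain ⟨ψ, -, hψ⟩ := a.exists_desc (0 : (0 : C) ⟶ c.pt) (fun k _ => c.inj k)
    (fun k _ => (isZero_zero C).eq_of_src _ _)
  have : IsIso ψ := ⟨φ, a.hom_ext ((isZero_zero C).eq_of_src _ _)
      (fun k hk => by rw [reassoc_of% (hψ k hk), hφ, Category.comp_id]),
    Cofan.IsColimit.hom_ext hc _ _ fun k => by
      rw [reassoc_of% (hφ k), hψ k (Set.mem_univ k), Category.comp_id]⟩
  have h0 : (0 : (0 : C) ⟶ c.pt) = a.base ≫ ψ := (isZero_zero C).eq_of_src _ _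
  change MorphismProperty.transfiniteCompositions.{v} _ _
  rw [h0]
  exact MorphismProperty.RespectsIso.postcomp _ ψ _ ha

/-! ### Approximations and the cotorsion pair -/

variable [HasBinaryBiproducts C]

/-- The cell objects lie between the cokernels and the filtered objects, whose orthogonals agree by
Eklof's lemma. -/
lemma rightPerp_cokers_eq_rightPerp_cellObjects {I : MorphismProperty C} (hI : I ≤ E.inflations) :
    E.rightPerp (E.cokers I) = E.rightPerp (cellObjects I) :=
  le_antisymm ((rightPerp_le_rightPerp_filt _).trans (rightPerp_antitone (cellObjects_le_filt hI)))
    (rightPerp_antitone (cokers_le_cellObjects I))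

lemma rightPerp_cokers_eq_rightPerp_filt {I : MorphismProperty C} (hI : I ≤ E.inflations) :
    E.rightPerp (E.cokers I) = E.rightPerp (E.filt (E.cokers I)) :=
  le_antisymm (rightPerp_le_rightPerp_filt _)
    (rightPerp_antitone ((cokers_le_cellObjects I).trans (cellObjects_le_filt hI)))

/-- In a factorization of `0 ⟶ X`, the second map lies in `I.rlp`, and `0 ⟶ A` lifts against such
maps for every cell object `A`. -/
lemma isPrecovering_cellObjects (hcomp : E.HasTransfiniteCompositions)
    (hsmall : ∀ X : C, IsSmallRelativeTo X E.inflations) {I : MorphismProperty C}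
    (hI : E.IsSetOfInflations I) : IsPrecovering (cellObjects I) := by
  intro X
  obtain ⟨Z, i, p, -, hi, hp⟩ := hcomp.exists_factorization hsmall hI (0 : (0 : C) ⟶ X)
  refine ⟨Z, p, ?_, fun A f hA => ?_⟩
  · rwa [(isZero_zero C).eq_of_src i 0] at hi
  · have hp' : I.pushouts.rlp p := by rwa [MorphismProperty.rlp_pushouts]
    have := MorphismProperty.transfiniteCompositions_le_llp_rlp _ _ hA p hp'
    have sq : CommSq (0 : (0 : C) ⟶ Z) (0 : (0 : C) ⟶ A) p f := ⟨by simp⟩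
    exact ⟨sq.lift, sq.fac_right⟩

/-- Factor `M ⟶ 0`: the lifting property of `T ⟶ 0` is, by homologicality, the vanishing of `Ext¹`
on the cokernels. -/
lemma IsHomological.exists_conflation (hcomp : E.HasTransfiniteCompositions)
    (hsmall : ∀ X : C, IsSmallRelativeTo X E.inflations) {I : MorphismProperty C}
    (hI : E.IsSetOfInflations I) (h : E.IsHomological I) (M : C) :
    ∃ (T X : C) (f : M ⟶ T) (g : T ⟶ X), MorphismProperty.transfiniteCompositions.{v} I.pushouts f ∧
      E.rightPerp (E.cokers I) T ∧ cellObjects I X ∧ E.IsConflation f g := by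
  obtain ⟨T, i, p, -, hi, hp⟩ := hcomp.exists_factorization hsmall hI (0 : M ⟶ 0)
  obtain ⟨X, g, hg⟩ := hcomp.transfiniteCompositions_le hI.pushouts_le _ hi
  replace hg : E.IsConflation i g := hg
  rw [(isZero_zero C).eq_of_tgt p 0] at hp
  exact ⟨T, X, i, g, hi, (h T).2 hp, hg.transfiniteCompositions_zero hcomp hI.pushouts_le hi, hg⟩

lemma IsHomological.isPreenveloping (hcomp : E.HasTransfiniteCompositions)
    (hsmall : ∀ X : C, IsSmallRelativeTo X E.inflations) {I : MorphismProperty C}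
    (hI : E.IsSetOfInflations I) (h : E.IsHomological I) :
    IsPreenveloping (E.rightPerp (E.cokers I)) := by
  intro M
  obtain ⟨T, X, f, g, hf, hT, -, -⟩ := h.exists_conflation hcomp hsmall hI M
  refine ⟨T, f, hT, fun T' f' hT' => ?_⟩
  have hp : I.pushouts.rlp (0 : T' ⟶ (0 : C)) := by
    rw [MorphismProperty.rlp_pushouts]
    exact (h T').1 hT'
  have := MorphismProperty.transfiniteCompositions_le_llp_rlp _ _ hf _ hp
  have sq : CommSq f' f (0 : T' ⟶ (0 : C)) (0 : T ⟶ (0 : C)) := ⟨by simp⟩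
  exact ⟨sq.lift, sq.fac_left⟩

/-- Salce's argument. -/
lemma IsHomological.exists_conflation_of_deflations (hcomp : E.HasTransfiniteCompositions)
    (hsmall : ∀ X : C, IsSmallRelativeTo X E.inflations) {I : MorphismProperty C}
    (hI : E.IsSetOfInflations I) (h : E.IsHomological I) {G M : C} {π : G ⟶ M}
    (hπ : E.deflations π) :
    ∃ (T P X : C) (a : T ⟶ P) (b : P ⟶ M) (c : G ⟶ P) (d : P ⟶ X),
      E.rightPerp (E.cokers I) T ∧ E.IsConflation a b ∧ E.IsConflation c d ∧ cellObjects I X ∧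
      MorphismProperty.transfiniteCompositions.{v} I.pushouts c := by
  obtain ⟨K, k, hk⟩ := hπ
  replace hk : E.IsConflation k π := hk
  obtain ⟨T, X, f, g, hf, hT, hX, hfg⟩ := h.exists_conflation hcomp hsmall hI K
  -- Both directions of this pushout are inflations with unchanged cokernels: `M` for `T ⟶ P`, and
  -- `X` for `G ⟶ P`.
  obtain ⟨P, c, a, hP, -⟩ := E.pushout_inflation k f hk.inflation
  obtain ⟨b, hb, -⟩ := hk.of_isPushout hP
  obtain ⟨d, hd, -⟩ := hfg.of_isPushout hP.flip
  exact ⟨T, P, X, a, b, c, d, hT, hb, hd, hX,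
    (hcomp.isStableUnderCobaseChange hI.pushouts_le).of_isPushout hP hf⟩

lemma filt_le_leftPerp_rightPerp (S : ObjectProperty C) :
    E.filt S ≤ E.leftPerp (E.rightPerp S) := fun X hX _ hY =>
  rightPerp_le_rightPerp_filt S _ hY X hX

lemma directSummands_filt_le_leftPerp (S : ObjectProperty C) :
    directSummands (E.filt S) ≤ E.leftPerp (E.rightPerp S) := by
  rintro M ⟨N, X, hX, ⟨e⟩⟩ Y hY
  exact Ext1IsZero.of_retract (biprod.inl ≫ e.inv) (e.hom ≫ biprod.fst) (by simp)
    (filt_le_leftPerp_rightPerp S X hX Y hY)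

/-- The left orthogonal class is closed under existing coproducts and extensions, so Salce's object
`P` stays in it. -/
lemma IsHomological.exists_conflation_of_isGenerating (hcomp : E.HasTransfiniteCompositions)
    (hsmall : ∀ X : C, IsSmallRelativeTo X E.inflations) {I : MorphismProperty C}
    (hI : E.IsSetOfInflations I) (h : E.IsHomological I)
    (hG : E.IsGenerating (E.leftPerp (E.rightPerp (E.cokers I)))) (M : C) :
    ∃ (T X : C) (f : T ⟶ X) (g : X ⟶ M), E.rightPerp (E.cokers I) T ∧
      E.leftPerp (E.rightPerp (E.cokers I)) X ∧ E.IsConflation f g := by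
  obtain ⟨K, A, c, π, hA, ⟨hc⟩, hπ⟩ := hG M
  obtain ⟨T, P, X, a, b, i, d, hT, hab, hid, hX, -⟩ :=
    h.exists_conflation_of_deflations hcomp hsmall hI hπ
  exact ⟨T, P, a, b, hT, fun Y hY => Ext1IsZero.extension hid
    (Ext1IsZero.cofan hc fun k => hA k Y hY)
    (filt_le_leftPerp_rightPerp _ _ (cellObjects_le_filt hI.2 _ hX) Y hY), hab⟩

lemma IsHomological.leftPerp_eq_directSummands (hcomp : E.HasTransfiniteCompositions)
    (hsmall : ∀ X : C, IsSmallRelativeTo X E.inflations) {I : MorphismProperty C}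
    (hI : E.IsSetOfInflations I) (h : E.IsHomological I)
    (hG : E.IsGenerating (E.filt (E.cokers I))) :
    E.leftPerp (E.rightPerp (E.cokers I)) = directSummands (E.filt (E.cokers I)) := by
  refine le_antisymm (fun M hM => ?_) (directSummands_filt_le_leftPerp _)
  obtain ⟨K, A, c, π, hA, ⟨hc⟩, hπ⟩ := hG M
  obtain ⟨T, P, X, a, b, i, d, hT, hab, -, -, hi⟩ :=
    h.exists_conflation_of_deflations hcomp hsmall hI hπ
  -- The filtration of the coproduct `c.pt` is continued along `i`; this uses that `i` itself, not
  -- just its cokernel, is built from cells.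
  have hW := E.inflationsWithCokerIn_le (E.cokers I)
  have := hcomp.isStableUnderTransfiniteComposition_transfiniteCompositions hW
  have hP : E.filt (E.cokers I) P := by
    change MorphismProperty.transfiniteCompositions.{v} _ _
    rw [← zero_comp (f := i)]
    exact MorphismProperty.comp_mem _ _ _ (filt_cofan hcomp hc hA)
      (MorphismProperty.transfiniteCompositions_monotone
        (pushouts_le_inflationsWithCokerIn hI.2) _ hi)
  -- Since `M` is orthogonal to `T`, the filtered object `P` splits as `T ⊞ M`.
  obtain ⟨t, ht⟩ := ext1IsZero_iff.1 (hM T hT) a b hab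
  obtain ⟨e, -, -⟩ := hab.exists_iso_biprod t ht
  exact ⟨T, P, hP, ⟨e ≪≫ biprod.braiding T M⟩⟩

end ExactStructure

/-! ### Assembly of the theorem -/

theorem mainTheorem1 {C : Type u} [Category.{v} C] [Preadditive C] [HasZeroObject C]
    [HasBinaryBiproducts C] (E : ExactStructure C)
    (hcomp : E.HasTransfiniteCompositions)
    (hsmall : ∀ X : C, IsSmallRelativeTo X E.inflations)
    (I : MorphismProperty C) (hI : E.IsSetOfInflations I) (hhom : E.IsHomological I)
    (S T : ObjectProperty C) (hS : S = E.cokers I) (hT : T = E.rightPerp S) :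
    IsPrecovering (cellObjects I) ∧
    (cellObjects I ≤ E.filt S ∧ (E.IsStronglyHomological I → cellObjects I = E.filt S)) ∧
    (T = E.rightPerp (cellObjects I) ∧ T = E.rightPerp (E.filt S)) ∧
    (IsPreenveloping T ∧
      ∀ M : C, ∃ (T' X : C) (f : M ⟶ T') (g : T' ⟶ X),
        T T' ∧ cellObjects I X ∧ E.IsConflation f g) ∧
    (E.IsGenerating (E.leftPerp T) →
      (∀ M : C, ∃ (T' X' : C) (f : T' ⟶ X') (g : X' ⟶ M),
        T T' ∧ E.leftPerp T X' ∧ E.IsConflation f g) ∧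
      E.IsCompleteCotorsionPair (E.leftPerp T) T) ∧
    (E.IsGenerating (E.filt S) → E.leftPerp T = directSummands (E.filt S)) := by
  subst hT hS
  refine ⟨ExactStructure.isPrecovering_cellObjects hcomp hsmall hI,
    ⟨ExactStructure.cellObjects_le_filt hI.2, fun h => h.cellObjects_eq_filt hI.2⟩,
    ⟨ExactStructure.rightPerp_cokers_eq_rightPerp_cellObjects hI.2,
      ExactStructure.rightPerp_cokers_eq_rightPerp_filt hI.2⟩,
    ⟨hhom.isPreenveloping hcomp hsmall hI, fun M => ?_⟩, fun hG => ?_,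
    hhom.leftPerp_eq_directSummands hcomp hsmall hI⟩
  · obtain ⟨T, X, f, g, -, hT, hX, hfg⟩ := hhom.exists_conflation hcomp hsmall hI M
    exact ⟨T, X, f, g, hT, hX, hfg⟩
  · have hleft := hhom.exists_conflation_of_isGenerating hcomp hsmall hI hG
    refine ⟨hleft, ExactStructure.rightPerp_leftPerp_rightPerp _, rfl, fun M => ?_, fun M => ?_⟩
    · obtain ⟨T, X, f, g, hT, hX, hfg⟩ := hleft M
      exact ⟨T, X, f, g, hX, hT, hfg⟩
    · obtain ⟨T, X, f, g, -, hT, hX, hfg⟩ := hhom.exists_conflation hcomp hsmall hI M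
      exact ⟨T, X, f, g, ExactStructure.filt_le_leftPerp_rightPerp _ _
        (ExactStructure.cellObjects_le_filt hI.2 _ hX), hT, hfg⟩
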